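/- Let $M$ be a one-dimensional complex manifold, with complex structure $J$, and let $G$ be a complex Lie group whose Lie algebra $\mathfrak g$ (a finite-dimensional complex Lie algebra) is semisimple. Let $\mathfrak g=\bigoplus_{m\in\mathbb Z}\mathfrak g_m$ be a $\mathbb Z$-gradation, i.e. $[\mathfrak g_m,\mathfrak g_k]\subset\mathfrak g_{m+k}$, and put $\tilde{\mathfrak b}_-=\bigoplus_{m\le 0}\mathfrak g_m$ and $\tilde{\mathfrak b}_+=\bigoplus_{m\ge 0}\mathfrak g_m$. Let $\tilde B_\pm$ be the connected Lie subgroups of $G$ with Lie algebras $\tilde{\mathfrak b}_\pm$ (that is, the subgroups generated by $\exp\tilde{\mathfrak b}_\pm$), and let $\pi_+:G\to F_+=G/\tilde B_-$ and $\pi_-:G\to F_-=G/\tilde B_+$ be the canonical projections onto the complex homogeneous spaces. Let $\varphi:M\to G$ be a smooth map (of real manifolds), and let ${}^\varphi\omega=\varphi^*\theta$ be the pullback of the Maurer–Cartan form $\theta_g=(L_{g^{-1}})_*$ of $G$; it is a $\mathfrak g$-valued $1$-form on $M$, with components $({}^\varphi\omega)^{(1,0)}=\tfrac12({}^\varphi\omega-i\,{}^\varphi\omega\circ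 J)$ and $({}^\varphi\omega)^{(0,1)}=\tfrac12({}^\varphi\omega+i\,{}^\varphi\omega\circ J)$. We say that ${}^\varphi\omega$ satisfies the grading condition if $({}^\varphi\omega)^{(1,0)}$ takes values in $\tilde{\mathfrak b}_-$ and $({}^\varphi\omega)^{(0,1)}$ takes values in $\tilde{\mathfrak b}_+$. Theorem. The connection ${}^\varphi\omega$ satisfies the grading condition if and only if the map $\varphi_-=\pi_-\circ\varphi:M\to G/\tilde B_+$ is holomorphic and the map $\varphi_+=\pi_+\circ\varphi:M\to G/\tilde B_-$ is antiholomorphic. Here the complex structure on a quotient $G/B$ is the natural one: a function on an open subset of $G/B$ is holomorphic exactly when its pullback to $G$ is. A map $M\to G/B$ is holomorphic (antiholomorphic) if it is continuous and pulls local holomorphic functions back to holomorphic (antiholomorphic) functions. -/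

import Mathlib

open scoped Manifold ContDiff

noncomputable section

namespace TodaGeometry

/-! ### Gradations of a complex Lie algebra -/

/-- A `ℤ`-gradation of a complex Lie algebra `L`: a direct sum decomposition `L = ⨁ L_m` with
`[L_m, L_k] ⊆ L_{m+k}`. -/
structure ZGradation (L : Type*) [LieRing L] [LieAlgebra ℂ L] where
  /-- The homogeneous subspace of degree `m`. -/
  piece : ℤ → Submodule ℂ L
  isInternal : DirectSum.IsInternal piece
  lie_mem : ∀ (m k : ℤ) (x y : L), x ∈ piece m → y ∈ piece k → ⁅x, y⁆ ∈ piece (m + k)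

namespace ZGradation

variable {L : Type*} [LieRing L] [LieAlgebra ℂ L]

theorem lie_mem_iSup (𝒜 : ZGradation L) (S : Set ℤ) (hS : ∀ m ∈ S, ∀ k ∈ S, m + k ∈ S) {x y : L}
    (hx : x ∈ ⨆ m ∈ S, 𝒜.piece m) (hy : y ∈ ⨆ m ∈ S, 𝒜.piece m) :
    ⁅x, y⁆ ∈ ⨆ m ∈ S, 𝒜.piece m := by
  rw [iSup_subtype'] at hx hy
  induction hx using Submodule.iSup_induction' with
  | zero => simp
  | add a b _ _ ha hb => rw [add_lie]; exact add_mem ha hb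
  | mem m a ha =>
    induction hy using Submodule.iSup_induction' with
    | zero => simp
    | add c d _ _ hc hd => rw [lie_add]; exact add_mem hc hd
    | mem k c hc =>
      exact Submodule.mem_iSup_of_mem (m.1 + k.1) (Submodule.mem_iSup_of_mem
        (hS _ m.2 _ k.2) (𝒜.lie_mem _ _ _ _ ha hc))

/-- The subalgebra `b̃₋ = ⨁_{m ≤ 0} L_m`. -/
def bMinus (𝒜 : ZGradation L) : LieSubalgebra ℂ L where
  toSubmodule := ⨆ m ∈ Set.Iic (0 : ℤ), 𝒜.piece m
  lie_mem' := fun hx hy => 𝒜.lie_mem_iSup (Set.Iic 0)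
    (fun _ hm _ hk => add_nonpos (Set.mem_Iic.1 hm) (Set.mem_Iic.1 hk)) hx hy

/-- The subalgebra `b̃₊ = ⨁_{m ≥ 0} L_m`. -/
def bPlus (𝒜 : ZGradation L) : LieSubalgebra ℂ L where
  toSubmodule := ⨆ m ∈ Set.Ici (0 : ℤ), 𝒜.piece m
  lie_mem' := fun hx hy => 𝒜.lie_mem_iSup (Set.Ici 0)
    (fun _ hm _ hk => add_nonneg (Set.mem_Ici.1 hm) (Set.mem_Ici.1 hk)) hx hy

end ZGradation

/-! ### One-forms on a complex curve, with values in a complex vector space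

The real tangent space of `M` at `p` is `TangentSpace 𝓘(ℝ, ℂ) p`, which is `ℂ` through the preferred
holomorphic chart at `p`; its complex structure is multiplication by `i`. A complex-linear form on
the complexified tangent space is the same as its restriction to the real tangent space, which is an
arbitrary real-linear map into a complex space. -/

section Forms

variable (M : Type*) [TopologicalSpace M] [ChartedSpace ℂ M]
  (V : Type*) [AddCommGroup V] [Module ℂ V]

/-- One-forms on `M` with values in the complex vector space `V`. -/
abbrev OneForm := (p : M) → TangentSpace 𝓘(ℝ, ℂ) p →ₗ[ℝ] V

variable {M V}

/-- The complex structure on the real tangent space of `M` at `p`. -/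
def complexStructure (p : M) : TangentSpace 𝓘(ℝ, ℂ) p →ₗ[ℝ] TangentSpace 𝓘(ℝ, ℂ) p :=
  (LinearMap.mulLeft ℝ Complex.I : ℂ →ₗ[ℝ] ℂ)

/-- The `(1,0)`-component `α ∘ P` of `α`, where `P = (1 - i J) / 2`. -/
def part10 (α : OneForm M V) : OneForm M V := fun p =>
  (1 / 2 : ℂ) • (α p - Complex.I • (α p ∘ₗ complexStructure p))

/-- The `(0,1)`-component `α ∘ P̄` of `α`, where `P̄ = (1 + i J) / 2`. -/
def part01 (α : OneForm M V) : OneForm M V := fun p =>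
  (1 / 2 : ℂ) • (α p + Complex.I • (α p ∘ₗ complexStructure p))

/-- `α` takes values in the subspace `W`. -/
def TakesValuesIn (α : OneForm M V) (W : Submodule ℂ V) : Prop :=
  ∀ (p : M) (v : TangentSpace 𝓘(ℝ, ℂ) p), α p v ∈ W

end Forms

/-! ### The Maurer-Cartan form and subgroups of a complex Lie group -/

section LieGroups

variable {E : Type*} [NormedAddCommGroup E] [NormedSpace ℂ E]
  {G : Type*} [TopologicalSpace G] [ChartedSpace E G] [Group G]

/-- The Maurer-Cartan form `θ_g = (L_{g⁻¹})_* : T_g G → 𝔤`. -/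
def maurerCartan (g : G) :
    TangentSpace 𝓘(ℂ, E) g →L[ℂ] GroupLieAlgebra 𝓘(ℂ, E) G :=
  (mfderiv 𝓘(ℂ, E) 𝓘(ℂ, E) (fun h : G => g⁻¹ * h) g : E →L[ℂ] E)

/-- The connection form `φ^* θ`, where `φ` is regarded as a map of real manifolds. -/
def connectionForm {M : Type*} [TopologicalSpace M] [ChartedSpace ℂ M] (φ : M → G) :
    OneForm M (GroupLieAlgebra 𝓘(ℂ, E) G) := fun p =>
  (((maurerCartan (E := E) (φ p) : E →L[ℂ] E).restrictScalars ℝ).comp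
    (mfderiv 𝓘(ℝ, ℂ) 𝓘(ℝ, E) φ p : ℂ →L[ℝ] E) : ℂ →L[ℝ] E).toLinearMap

/-- `g = exp X`: the element `g` is the value at time `1` of the integral curve, through the
identity, of the left-invariant vector field on `G` determined by `X`. -/
def IsExp (X : GroupLieAlgebra 𝓘(ℂ, E) G) (g : G) : Prop :=
  ∃ γ : ℝ → G, γ 0 = 1 ∧ γ 1 = g ∧
    IsMIntegralCurve (I := 𝓘(ℝ, E)) γ
      (fun h : G => (mulInvariantVectorField (I := 𝓘(ℂ, E)) X h : E))

variable [FiniteDimensional ℂ E] [LieGroup 𝓘(ℂ, E) ω G]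

/-- The connected (immersed) Lie subgroup of `G` with Lie algebra `𝔥`: the subgroup generated by
`exp 𝔥`. -/
def connectedSubgroup (𝔥 : LieSubalgebra ℂ (GroupLieAlgebra 𝓘(ℂ, E) G)) : Subgroup G :=
  Subgroup.closure {g | ∃ X ∈ 𝔥, IsExp X g}

end LieGroups

/-! ### Holomorphic and antiholomorphic maps into a homogeneous space

The complex structure of the homogeneous space `G ⧸ B` of a complex Lie group is described by its
holomorphic functions: a function on an open subset of `G ⧸ B` is holomorphic if and only if its
pullback to `G` is. A continuous map into `G ⧸ B` is (anti)holomorphic if and only if it pulls local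
holomorphic functions back to (anti)holomorphic functions. -/

section Homogeneous

variable (E : Type*) [NormedAddCommGroup E] [NormedSpace ℂ E]
  {G : Type*} [TopologicalSpace G] [ChartedSpace E G] [Group G] {B : Subgroup G}
  {M : Type*} [TopologicalSpace M] [ChartedSpace ℂ M]

/-- `f` is holomorphic on the open set `U ⊆ G ⧸ B`. Values of `f` outside `U` are irrelevant. -/
def IsHolomorphicFunOn (f : G ⧸ B → ℂ) (U : Set (G ⧸ B)) : Prop :=
  MDifferentiableOn 𝓘(ℂ, E) 𝓘(ℂ) (fun g : G => f (QuotientGroup.mk g)) (QuotientGroup.mk ⁻¹' U)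

/-- The map `ψ : M → G ⧸ B` is holomorphic. -/
def IsHolomorphicMap (ψ : M → G ⧸ B) : Prop :=
  Continuous ψ ∧ ∀ (U : Set (G ⧸ B)) (f : G ⧸ B → ℂ), IsOpen U → IsHolomorphicFunOn E f U →
    MDifferentiableOn 𝓘(ℂ) 𝓘(ℂ) (fun p => f (ψ p)) (ψ ⁻¹' U)

/-- The map `ψ : M → G ⧸ B` is antiholomorphic. -/
def IsAntiholomorphicMap (ψ : M → G ⧸ B) : Prop :=
  Continuous ψ ∧ ∀ (U : Set (G ⧸ B)) (f : G ⧸ B → ℂ), IsOpen U → IsHolomorphicFunOn E f U →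
    MDifferentiableOn 𝓘(ℂ) 𝓘(ℂ) (fun p => starRingEnd ℂ (f (ψ p))) (ψ ⁻¹' U)

end Homogeneous

/-! ### The grading condition and the two projections -/

section Grading

variable {E : Type*} [NormedAddCommGroup E] [NormedSpace ℂ E] [FiniteDimensional ℂ E]
  {G : Type*} [TopologicalSpace G] [ChartedSpace E G] [Group G] [LieGroup 𝓘(ℂ, E) ω G]
  {M : Type*} [TopologicalSpace M] [ChartedSpace ℂ M]

/-- The grading condition on a `𝔤`-valued one-form: its `(1,0)`-component takes values in `b̃₋` and
its `(0,1)`-component takes values in `b̃₊`. -/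
def GradingCondition (𝒜 : ZGradation (GroupLieAlgebra 𝓘(ℂ, E) G))
    (α : OneForm M (GroupLieAlgebra 𝓘(ℂ, E) G)) : Prop :=
  TakesValuesIn (part10 α) 𝒜.bMinus.toSubmodule ∧ TakesValuesIn (part01 α) 𝒜.bPlus.toSubmodule

/-- The connected subgroup `B̃₋` with Lie algebra `b̃₋`. -/
def groupBMinus (𝒜 : ZGradation (GroupLieAlgebra 𝓘(ℂ, E) G)) : Subgroup G :=
  connectedSubgroup 𝒜.bMinus

/-- The connected subgroup `B̃₊` with Lie algebra `b̃₊`. -/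
def groupBPlus (𝒜 : ZGradation (GroupLieAlgebra 𝓘(ℂ, E) G)) : Subgroup G :=
  connectedSubgroup 𝒜.bPlus

/-- `φ₋ = π₋ ∘ φ : M → F₋ = G / B̃₊`. -/
def phiMinus (𝒜 : ZGradation (GroupLieAlgebra 𝓘(ℂ, E) G)) (φ : M → G) : M → G ⧸ groupBPlus 𝒜 :=
  fun p => QuotientGroup.mk (φ p)

/-- `φ₊ = π₊ ∘ φ : M → F₊ = G / B̃₋`. -/
def phiPlus (𝒜 : ZGradation (GroupLieAlgebra 𝓘(ℂ, E) G)) (φ : M → G) : M → G ⧸ groupBMinus 𝒜 :=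
  fun p => QuotientGroup.mk (φ p)

end Grading

end TodaGeometry

end

/-!
Write `ω` for the connection form of `φ`, so that `dφ = dL_φ ∘ ω`, and fix a subalgebra `𝔥` of `𝔤` with
connected subgroup `H`. Let `f` be holomorphic on an open subset of `G ⧸ H` and let `A` be the
complex-linear differential of its pullback to `G` at the point `φ p`. The differential of
`f ∘ π ∘ φ` at `p` is the real-linear map `A ∘ dL ∘ ω`, and by the Cauchy-Riemann equation it is
complex linear if and only if `A ∘ dL` annihilates `ω v + i ω (i v)`, which is twice the value of the
`(0,1)`-component of `ω`. Similarly it is antilinear if and only if `A ∘ dL` annihilates the values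
of the `(1,0)`-component. So the theorem says that the covectors `A ∘ dL` have exactly `𝔥` as their
common kernel, for `𝔥 = b̃₊` and `𝔥 = b̃₋`.

They vanish on `𝔥` because the pullback of `f` is constant along the curves `g exp(tX)` with `X ∈ 𝔥`
(`map_leftTranslation_eq_zero`); these curves are complete by the uniform time lemma
(`exists_integralCurve`).

Conversely there must be enough local holomorphic functions on `G ⧸ H`. Neither the closedness of `H`
nor a manifold structure on `G ⧸ H` is used. As `Ad h` preserves `𝔥` for `h ∈ H`, the subspace
`Ad g (𝔥)` of `𝔤` depends on the coset `g H` only, so a chart of the Grassmannian around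
`Ad g₀ (𝔥)` gives holomorphic functions on `G ⧸ H` near `g₀ H`. Their differentials at `g₀` annihilate
`dL X` if and only if `ad X` preserves `𝔥` (`exists_holomorphicFun`). This uses that the derivative of
`Ad` at `1` is the bracket of left-invariant vector fields (`hasMFDerivAt_Ad_one`), which is
a computation with second derivatives of the multiplication in a chart.

Semisimplicity enters at the end: the derivation of `𝔤` which multiplies by `m` on `𝔤_m` is inner, by
Cartan's criterion, hence `ad h` for some `h` of degree `0`, and if `ad X` preserves `b̃₊`
then `[h, X] ∈ b̃₊`, which forces `X ∈ b̃₊`. So `b̃₊` and `b̃₋` are self-normalizing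
(`ZGradation.mem_of_forall_lie_mem`).
-/

noncomputable section

namespace TodaGeometry

open Topology Filter

/-! ### Self-normalizing subalgebras of a graded semisimple Lie algebra -/

namespace ZGradation

variable {L : Type*} [LieRing L] [LieAlgebra ℂ L]

/-- The identification of `L` with the direct sum of its homogeneous subspaces. -/
def coeEquiv (𝒜 : ZGradation L) : (DirectSum ℤ fun m => 𝒜.piece m) ≃ₗ[ℂ] L :=
  LinearEquiv.ofBijective (DirectSum.coeLinearMap 𝒜.piece) 𝒜.isInternal

theorem coeEquiv_symm_apply (𝒜 : ZGradation L) {m : ℤ} {x : L} (hx : x ∈ 𝒜.piece m) :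
    𝒜.coeEquiv.symm x = DirectSum.lof ℂ ℤ (fun i => 𝒜.piece i) m ⟨x, hx⟩ := by
  rw [LinearEquiv.symm_apply_eq]
  exact (DirectSum.coeLinearMap_lof 𝒜.piece m ⟨x, hx⟩).symm

/-- The degree operator of a gradation: it multiplies by `m` on the homogeneous subspace of
degree `m`. -/
def degree (𝒜 : ZGradation L) : L →ₗ[ℂ] L :=
  DirectSum.toModule ℂ ℤ L (fun m => (m : ℂ) • (𝒜.piece m).subtype) ∘ₗ
    𝒜.coeEquiv.symm.toLinearMap

theorem degree_apply (𝒜 : ZGradation L) {m : ℤ} {x : L} (hx : x ∈ 𝒜.piece m) :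
    𝒜.degree x = (m : ℂ) • x := by
  simp [degree, 𝒜.coeEquiv_symm_apply hx]

theorem induction_homogeneous (𝒜 : ZGradation L) {p : L → Prop} (h0 : p 0)
    (hadd : ∀ x y, p x → p y → p (x + y)) (hm : ∀ m, ∀ x ∈ 𝒜.piece m, p x) (x : L) : p x := by
  have hx : x ∈ ⨆ m, 𝒜.piece m := by
    rw [𝒜.isInternal.submodule_iSup_eq_top]; trivial
  induction hx using Submodule.iSup_induction' with
  | zero => exact h0
  | add a b _ _ ha hb => exact hadd a b ha hb
  | mem m a ha => exact hm m a ha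

theorem degree_lie (𝒜 : ZGradation L) (x y : L) :
    𝒜.degree ⁅x, y⁆ = ⁅x, 𝒜.degree y⁆ - ⁅y, 𝒜.degree x⁆ := by
  induction x using 𝒜.induction_homogeneous with
  | h0 => simp
  | hadd a b ha hb => simp only [add_lie, map_add, ha, hb, lie_add]; abel
  | hm m a ha =>
    induction y using 𝒜.induction_homogeneous with
    | h0 => simp
    | hadd c d hc hd => simp only [add_lie, map_add, hc, hd, lie_add]; abel
    | hm k c hc =>
      rw [𝒜.degree_apply ha, 𝒜.degree_apply hc, 𝒜.degree_apply (𝒜.lie_mem _ _ _ _ ha hc),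
        lie_smul, lie_smul, ← lie_skew a c, smul_neg, smul_neg, Int.cast_add, add_smul]
      abel

/-- The degree operator as a derivation. -/
def degreeDerivation (𝒜 : ZGradation L) : LieDerivation ℂ L L where
  toLinearMap := 𝒜.degree
  leibniz' := 𝒜.degree_lie

/-- Projection to the homogeneous component of degree `m`. -/
def component (𝒜 : ZGradation L) (m : ℤ) : L →ₗ[ℂ] L :=
  (𝒜.piece m).subtype ∘ₗ DirectSum.component ℂ ℤ (fun i => 𝒜.piece i) m ∘ₗ
    𝒜.coeEquiv.symm.toLinearMap

theorem component_apply (𝒜 : ZGradation L) (m : ℤ) {k : ℤ} {x : L} (hx : x ∈ 𝒜.piece k) :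
    𝒜.component m x = if k = m then x else 0 := by
  simp only [component, LinearMap.comp_apply, LinearEquiv.coe_coe, 𝒜.coeEquiv_symm_apply hx, DirectSum.component.of]
  split_ifs with h'
  · subst h'; simp
  · simp

theorem component_degree (𝒜 : ZGradation L) (m : ℤ) (x : L) :
    𝒜.component m (𝒜.degree x) = (m : ℂ) • 𝒜.component m x := by
  induction x using 𝒜.induction_homogeneous with
  | h0 => simp
  | hadd a b ha hb => simp [ha, hb]
  | hm k a ha =>
    rw [𝒜.degree_apply ha, map_smul, 𝒜.component_apply m ha]
    split_ifs with h
    · rw [h]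
    · simp

theorem mem_iSup_iff_component (𝒜 : ZGradation L) (S : Set ℤ) (x : L) :
    x ∈ ⨆ m ∈ S, 𝒜.piece m ↔ ∀ m ∉ S, 𝒜.component m x = 0 := by
  classical
  constructor
  · intro hx m hm
    rw [iSup_subtype'] at hx
    induction hx using Submodule.iSup_induction' with
    | zero => simp
    | add a b _ _ ha hb => simp [ha, hb]
    | mem k a ha =>
      rw [𝒜.component_apply m ha, if_neg]
      rintro rfl
      exact hm k.2
  · intro h
    set z := 𝒜.coeEquiv.symm x with hz
    have hx : x = DirectSum.coeLinearMap 𝒜.piece z :=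
      (𝒜.coeEquiv.apply_symm_apply x).symm
    rw [hx, DirectSum.coeLinearMap_eq_dfinsuppSum, DFinsupp.sum]
    refine sum_mem fun m _ => ?_
    by_cases hm : m ∈ S
    · exact Submodule.mem_iSup_of_mem m (Submodule.mem_iSup_of_mem hm (z m).2)
    · have := h m hm
      have h2 : ((z m : 𝒜.piece m) : L) = 0 := this
      rw [h2]
      exact zero_mem _

/-- The sum of the homogeneous subspaces with degrees in `S ∋ 0` is its own normalizer. The degree
operator is inner, `degree = ad h`, and `h` has degree `0`. So if `x` normalizes the sum, then
`⁅h, x⁆` lies in it; this is `x` with its components multiplied by their degrees, and only the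
component of degree `0`, which lies in the sum anyway, is lost. -/
theorem mem_of_forall_lie_mem [FiniteDimensional ℂ L] [LieAlgebra.IsSemisimple ℂ L]
    (𝒜 : ZGradation L) {S : Set ℤ} (hS : 0 ∈ S) {x : L}
    (hx : ∀ y ∈ ⨆ m ∈ S, 𝒜.piece m, ⁅x, y⁆ ∈ ⨆ m ∈ S, 𝒜.piece m) :
    x ∈ ⨆ m ∈ S, 𝒜.piece m := by
  obtain ⟨h, hh⟩ := LieDerivation.IsKilling.exists_eq_ad 𝒜.degreeDerivation
  have hh' : ∀ y, ⁅h, y⁆ = 𝒜.degree y := fun y => by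
    have := congrArg (fun D : LieDerivation ℂ L L => D y) hh
    have h2 : ⁅h, y⁆ = 𝒜.degreeDerivation y := by simpa using this
    exact h2
  have hmem : h ∈ ⨆ m ∈ S, 𝒜.piece m := by
    rw [mem_iSup_iff_component]
    intro m hm
    have hm0 : (m : ℂ) ≠ 0 := by
      rintro h0
      exact hm (by rwa [Int.cast_eq_zero.1 h0])
    have h1 := 𝒜.component_degree m h
    rw [← hh' h, lie_self, map_zero] at h1
    exact (smul_eq_zero.1 h1.symm).resolve_left hm0
  have h2 := hx h hmem
  rw [mem_iSup_iff_component] at h2 ⊢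
  intro m hm
  have hm0 : (m : ℂ) ≠ 0 := by
    rintro h0
    exact hm (by rwa [Int.cast_eq_zero.1 h0])
  have h3 := h2 m hm
  rw [← lie_skew, hh', map_neg, component_degree, neg_eq_zero] at h3
  exact (smul_eq_zero.1 h3).resolve_left hm0

theorem bMinus_self_normalizing [FiniteDimensional ℂ L] [LieAlgebra.IsSemisimple ℂ L]
    (𝒜 : ZGradation L) (x : L) (hx : ∀ y ∈ 𝒜.bMinus, ⁅x, y⁆ ∈ 𝒜.bMinus) : x ∈ 𝒜.bMinus :=
  𝒜.mem_of_forall_lie_mem (S := Set.Iic 0) (Set.mem_Iic.2 le_rfl) hx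

theorem bPlus_self_normalizing [FiniteDimensional ℂ L] [LieAlgebra.IsSemisimple ℂ L]
    (𝒜 : ZGradation L) (x : L) (hx : ∀ y ∈ 𝒜.bPlus, ⁅x, y⁆ ∈ 𝒜.bPlus) : x ∈ 𝒜.bPlus :=
  𝒜.mem_of_forall_lie_mem (S := Set.Ici 0) (Set.mem_Ici.2 le_rfl) hx

end ZGradation

/-! ### The real manifold underlying a complex manifold -/

section RestrictScalars

variable {E : Type*} [NormedAddCommGroup E] [NormedSpace ℂ E]
  {F : Type*} [NormedAddCommGroup F] [NormedSpace ℂ F]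
  {N : Type*} [TopologicalSpace N] [ChartedSpace E N]
  {M : Type*} [TopologicalSpace M] [ChartedSpace F M]

theorem hasMFDerivAt_restrictScalars {f : M → N} {x : M} {f' : F →L[ℂ] E}
    (h : HasMFDerivAt 𝓘(ℂ, F) 𝓘(ℂ, E) f x f') :
    HasMFDerivAt 𝓘(ℝ, F) 𝓘(ℝ, E) f x (f'.restrictScalars ℝ : F →L[ℝ] E) :=
  ⟨h.1, h.2.restrictScalars ℝ⟩

/-- A real-differentiable map with complex-linear derivative is complex differentiable. -/
theorem HasMFDerivAt.of_restrictScalars {f : M → N} {x : M} {f' : F →L[ℂ] E}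
    (h : HasMFDerivAt 𝓘(ℝ, F) 𝓘(ℝ, E) f x (f'.restrictScalars ℝ : F →L[ℝ] E)) :
    HasMFDerivAt 𝓘(ℂ, F) 𝓘(ℂ, E) f x f' :=
  ⟨h.1, HasFDerivWithinAt.of_restrictScalars ℝ h.2 rfl⟩

/-- The derivative of a holomorphic function along a curve in the underlying real manifold. -/
theorem hasDerivAt_comp_curve {γ : ℝ → N} {t : ℝ} {v : E} {f : N → F} {f' : E →L[ℂ] F}
    (h : HasMFDerivAt 𝓘(ℝ, ℝ) 𝓘(ℝ, E) γ t ((1 : ℝ →L[ℝ] ℝ).smulRight v : ℝ →L[ℝ] E))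
    (hf : HasMFDerivAt 𝓘(ℂ, E) 𝓘(ℂ, F) f (γ t) f') :
    HasDerivAt (fun s => f (γ s)) (f' v) t := by
  have h1 := HasMFDerivAt.comp t (hasMFDerivAt_restrictScalars hf) h
  have h2 : HasFDerivAt (𝕜 := ℝ) (fun s => f (γ s))
      ((f'.restrictScalars ℝ).comp ((1 : ℝ →L[ℝ] ℝ).smulRight v)) t :=
    hasMFDerivAt_iff_hasFDerivAt.1 h1
  refine h2.hasDerivAt.congr_deriv ?_
  change f' ((1 : ℝ) • v) = f' v
  rw [one_smul]

theorem isManifold_restrictScalars (n : ℕ∞ω) [IsManifold 𝓘(ℂ, E) n N] : IsManifold 𝓘(ℝ, E) n N :=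
  isManifold_of_contDiffOn _ _ _ fun _ _ he he' =>
    ((contDiffGroupoid n 𝓘(ℂ, E)).compatible he he').1.restrict_scalars ℝ

theorem lieGroup_restrictScalars (n : ℕ∞ω) [Group N] [LieGroup 𝓘(ℂ, E) n N] :
    LieGroup 𝓘(ℝ, E) n N :=
  { isManifold_restrictScalars (E := E) (N := N) n with
    contMDiff_mul := fun x => by
      have h := contMDiffAt_iff.1 (contMDiff_mul 𝓘(ℂ, E) n (G := N) x)
      exact contMDiffAt_iff.2 ⟨h.1, h.2.restrict_scalars ℝ⟩
    contMDiff_inv := fun x => by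
      have h := contMDiffAt_iff.1 (contMDiff_inv 𝓘(ℂ, E) n (G := N) x)
      exact contMDiffAt_iff.2 ⟨h.1, h.2.restrict_scalars ℝ⟩ }

end RestrictScalars

/-! ### The second-order expansion of a group law -/

section Calculus
variable {E : Type*} [NormedAddCommGroup E] [NormedSpace ℂ E]

/-- Let `μ` be a multiplication with neutral element `x₀`, and `κ` the conjugation, so that
`μ (κ (x, z), x) = μ (x, z)`. Differentiating this in `z` at `x₀`, and then in `x` at `x₀`, expresses
the derivative of the adjoint representation by the second derivative `Q` of `μ`: both sides are
`Q (X, 0) (0, y) - Q (y, 0) (0, X)`. -/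
theorem fderiv_conjugation_eq_bracket {μ κ : E × E → E} {x₀ : E}
    (hμ : ContDiffAt ℂ 2 μ (x₀, x₀)) (hκ : ContDiffAt ℂ 2 κ (x₀, x₀))
    (hμ₁ : ∀ᶠ w in 𝓝 x₀, μ (w, x₀) = w) (hκ₁ : ∀ᶠ x in 𝓝 x₀, κ (x, x₀) = x₀)
    (hκ₂ : ∀ᶠ z in 𝓝 x₀, κ (x₀, z) = z) (hid : ∀ᶠ p in 𝓝 (x₀, x₀), μ (κ p, p.1) = μ p) (X y : E) :
    fderiv ℂ (fun x => (fderiv ℂ κ (x, x₀)).comp (ContinuousLinearMap.inr ℂ E E)) x₀ X y =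
      fderiv ℂ (fun x => (fderiv ℂ μ (x, x₀)).comp (ContinuousLinearMap.inr ℂ E E)) x₀ X y -
      fderiv ℂ (fun x => (fderiv ℂ μ (x, x₀)).comp (ContinuousLinearMap.inr ℂ E E)) x₀ y X := by
  have hdμ : DifferentiableAt ℂ (fderiv ℂ μ) (x₀, x₀) :=
    (hμ.fderiv_right (m := 1) le_rfl).differentiableAt one_ne_zero
  have hdκ : DifferentiableAt ℂ (fderiv ℂ κ) (x₀, x₀) :=
    (hκ.fderiv_right (m := 1) le_rfl).differentiableAt one_ne_zero
  have hl : HasFDerivAt (fun x : E => (x, x₀)) (ContinuousLinearMap.inl ℂ E E) x₀ :=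
    hasFDerivAt_prodMk_left x₀ x₀
  have hr : HasFDerivAt (fun x : E => (x₀, x)) (ContinuousLinearMap.inr ℂ E E) x₀ :=
    hasFDerivAt_prodMk_right x₀ x₀
  set Q := fderiv ℂ (fderiv ℂ μ) (x₀, x₀) with hQ
  have hsymm : ∀ v w, Q v w = Q w v := fun v w =>
    (hμ.isSymmSndFDerivAt (by simp)).eq v w
  -- the three partial derivatives, and their derivatives at the base point
  set A : E → E →L[ℂ] E := fun x => (fderiv ℂ μ (x₀, x)).comp (ContinuousLinearMap.inl ℂ E E)
  set B : E → E →L[ℂ] E := fun x => (fderiv ℂ μ (x, x₀)).comp (ContinuousLinearMap.inr ℂ E E)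
  set K : E → E →L[ℂ] E := fun x => (fderiv ℂ κ (x, x₀)).comp (ContinuousLinearMap.inr ℂ E E)
  have hA : HasFDerivAt A (((ContinuousLinearMap.compL ℂ E (E × E) E).flip
      (ContinuousLinearMap.inl ℂ E E)).comp (Q.comp (ContinuousLinearMap.inr ℂ E E))) x₀ :=
    ((ContinuousLinearMap.compL ℂ E (E × E) E).flip
      (ContinuousLinearMap.inl ℂ E E)).hasFDerivAt.comp x₀ (hdμ.hasFDerivAt.comp x₀ hr)
  have hB : HasFDerivAt B (((ContinuousLinearMap.compL ℂ E (E × E) E).flip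
      (ContinuousLinearMap.inr ℂ E E)).comp (Q.comp (ContinuousLinearMap.inl ℂ E E))) x₀ :=
    ((ContinuousLinearMap.compL ℂ E (E × E) E).flip
      (ContinuousLinearMap.inr ℂ E E)).hasFDerivAt.comp x₀ (hdμ.hasFDerivAt.comp (f := fun x : E => (x, x₀)) x₀ hl)
  have hK : HasFDerivAt K (((ContinuousLinearMap.compL ℂ E (E × E) E).flip
      (ContinuousLinearMap.inr ℂ E E)).comp
        ((fderiv ℂ (fderiv ℂ κ) (x₀, x₀)).comp (ContinuousLinearMap.inl ℂ E E))) x₀ :=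
    ((ContinuousLinearMap.compL ℂ E (E × E) E).flip
      (ContinuousLinearMap.inr ℂ E E)).hasFDerivAt.comp x₀ (hdκ.hasFDerivAt.comp (f := fun x : E => (x, x₀)) x₀ hl)
  have hμd : ∀ᶠ p in 𝓝 (x₀, x₀), DifferentiableAt ℂ μ p :=
    (hμ.eventually (by simp)).mono fun p hp => hp.differentiableAt two_ne_zero
  have hκd : ∀ᶠ p in 𝓝 (x₀, x₀), DifferentiableAt ℂ κ p :=
    (hκ.eventually (by simp)).mono fun p hp => hp.differentiableAt two_ne_zero
  have hA₀ : A x₀ = ContinuousLinearMap.id ℂ E := by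
    have h1 : HasFDerivAt (fun w => μ (w, x₀)) (A x₀) x₀ :=
      hμd.self_of_nhds.hasFDerivAt.comp (f := fun x : E => (x, x₀)) x₀ hl
    exact h1.unique ((hasFDerivAt_id x₀).congr_of_eventuallyEq hμ₁)
  have hK₀ : K x₀ = ContinuousLinearMap.id ℂ E := by
    have h1 : HasFDerivAt (fun w => κ (x₀, w)) (K x₀) x₀ :=
      hκd.self_of_nhds.hasFDerivAt.comp x₀ hr
    exact h1.unique ((hasFDerivAt_id x₀).congr_of_eventuallyEq hκ₂)
  have hlc : Tendsto (fun x : E => (x, x₀)) (𝓝 x₀) (𝓝 (x₀, x₀)) := hl.continuousAt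
  have hrc : Tendsto (fun x : E => (x₀, x)) (𝓝 x₀) (𝓝 (x₀, x₀)) := hr.continuousAt
  have hAK : (fun x => (A x).comp (K x)) =ᶠ[𝓝 x₀] B := by
    filter_upwards [hκ₁, hlc.eventually hκd, hlc.eventually hμd, hrc.eventually hμd,
      hlc.eventually hid.eventually_nhds] with x h1 h2 h3 h4 h5
    have hrx : HasFDerivAt (fun z : E => (x, z)) (ContinuousLinearMap.inr ℂ E E) x₀ :=
      hasFDerivAt_prodMk_right x x₀
    have k1 : HasFDerivAt (fun z => κ (x, z)) (K x) x₀ := h2.hasFDerivAt.comp x₀ hrx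
    have k2 : HasFDerivAt (fun w : E => μ (w, x)) (A x) (κ (x, x₀)) := by
      rw [h1]
      exact h4.hasFDerivAt.comp x₀ (hasFDerivAt_prodMk_left x₀ x)
    have k3 : HasFDerivAt (fun z => μ (κ (x, z), x)) ((A x).comp (K x)) x₀ :=
      HasFDerivAt.comp (g := fun w => μ (w, x)) x₀ k2 k1
    have k4 : HasFDerivAt (fun z => μ (x, z)) (B x) x₀ := h3.hasFDerivAt.comp x₀ hrx
    have h6 : ∀ᶠ z in 𝓝 x₀, μ (κ (x, z), x) = μ (x, z) :=
      hrx.continuousAt.tendsto.eventually h5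
    exact (k3.congr_of_eventuallyEq (h6.mono fun z hz => hz.symm)).unique k4
  have hder := (hA.clm_comp hK).unique (hB.congr_of_eventuallyEq hAK)
  have h := congrArg (fun T : E →L[ℂ] E →L[ℂ] E => T X y) hder
  have hfB : ∀ v w, fderiv ℂ B x₀ v w = Q (v, 0) (0, w) := fun v w => by
    rw [hB.fderiv]; simp
  have hfK := hK.fderiv
  have h' : fderiv ℂ K x₀ X y + Q (0, X) (y, 0) = Q (X, 0) (0, y) := by
    rw [hfK]
    simpa [hA₀, hK₀] using h
  rw [hfB, hfB, hsymm (y, 0), ← h']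
  abel

end Calculus

/-- The Lie bracket of two vector fields `x ↦ B x X` and `x ↦ B x y` at a point where `B` is
the identity. -/
theorem lieBracketWithin_univ_eq_of_eventuallyEq {E : Type*} [NormedAddCommGroup E]
    [NormedSpace ℂ E] {V W : E → E} {B : E → E →L[ℂ] E} {x₀ X y : E}
    (hB : DifferentiableAt ℂ B x₀) (hB₀ : B x₀ = ContinuousLinearMap.id ℂ E)
    (hV : ∀ᶠ x in 𝓝 x₀, V x = B x X) (hW : ∀ᶠ x in 𝓝 x₀, W x = B x y) :
    VectorField.lieBracketWithin ℂ V W Set.univ x₀ =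
      fderiv ℂ B x₀ X y - fderiv ℂ B x₀ y X := by
  have h : ∀ (U : E → E) (z : E), (∀ᶠ x in 𝓝 x₀, U x = B x z) →
      U x₀ = z ∧ ∀ v, fderiv ℂ U x₀ v = fderiv ℂ B x₀ v z := by
    intro U z hU
    refine ⟨by rw [hU.self_of_nhds, hB₀]; rfl, fun v => ?_⟩
    have h1 : HasFDerivAt (fun x => B x z)
        ((ContinuousLinearMap.apply ℂ E z).comp (fderiv ℂ B x₀)) x₀ :=
      (ContinuousLinearMap.apply ℂ E z).hasFDerivAt.comp x₀ hB.hasFDerivAt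
    rw [(h1.congr_of_eventuallyEq hU).fderiv]
    rfl
  rw [VectorField.lieBracketWithin_univ, VectorField.lieBracket_eq]
  simp only [(h V X hV).1, (h V X hV).2, (h W y hW).1, (h W y hW).2]

/-- A version of `ContinuousLinearMap.inverse_id` for maps whose source and target are only
definitionally equal to `E`, such as tangent spaces at different points. -/
theorem inverse_eq_id {E : Type*} [NormedAddCommGroup E] [NormedSpace ℂ E] {T : E →L[ℂ] E}
    (hT : T = ContinuousLinearMap.id ℂ E) :
    ContinuousLinearMap.inverse T = ContinuousLinearMap.id ℂ E := by
  rw [hT, ContinuousLinearMap.inverse_id]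

/-! ### Derivatives in the preferred charts -/

section Charts

variable {E : Type*} [NormedAddCommGroup E] [NormedSpace ℂ E]
  {F : Type*} [NormedAddCommGroup F] [NormedSpace ℂ F]
  {M : Type*} [TopologicalSpace M] [ChartedSpace E M]
  {N : Type*} [TopologicalSpace N] [ChartedSpace F N]

theorem hasMFDerivAt_of_eq {f : M → N} {x y : M} {f' : E →L[ℂ] F}
    (h : HasMFDerivAt 𝓘(ℂ, E) 𝓘(ℂ, F) f x f') (hxy : x = y) :
    HasMFDerivAt 𝓘(ℂ, E) 𝓘(ℂ, F) f y f' := by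
  subst hxy; exact h

/-- Passing to the preferred charts at `x` and at the image `y` of `x`. -/
theorem hasFDerivAt_chart_of_hasMFDerivAt {f : M → N} {x : M} {y : N} {f' : E →L[ℂ] F}
    (h : HasMFDerivAt 𝓘(ℂ, E) 𝓘(ℂ, F) f x f') (hy : f x = y) :
    HasFDerivAt (fun z => extChartAt 𝓘(ℂ, F) y (f ((extChartAt 𝓘(ℂ, E) x).symm z))) f'
      (extChartAt 𝓘(ℂ, E) x x) := by
  subst hy
  exact HasFDerivWithinAt.hasFDerivAt (s := Set.range 𝓘(ℂ, E)) h.2 (by simp)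

/-- The tangent space is identified with the model space through the preferred chart, so that
the derivative of this chart at its centre is the identity. -/
theorem hasMFDerivAt_extChartAt_self [IsManifold 𝓘(ℂ, E) 1 M] (x : M) :
    HasMFDerivAt 𝓘(ℂ, E) 𝓘(ℂ, E) (extChartAt 𝓘(ℂ, E) x) x (ContinuousLinearMap.id ℂ E) := by
  have h := (mdifferentiableAt_extChartAt (I := 𝓘(ℂ, E))
    (ChartedSpace.mem_chart_source (H := E) x)).hasMFDerivAt
  rw [mfderiv_extChartAt_self] at h
  exact h

end Charts

/-! ### The adjoint representation of a complex Lie group -/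

section Adjoint

variable {E : Type*} [NormedAddCommGroup E] [NormedSpace ℂ E]
  {G : Type*} [TopologicalSpace G] [ChartedSpace E G] [Group G]

/-- The adjoint representation: `Ad E g` is the derivative at `1` of `h ↦ g h g⁻¹`. The Lie algebra
is regarded as the normed space `E`, through the preferred chart at `1`. -/
def Ad (E : Type*) [NormedAddCommGroup E] [NormedSpace ℂ E]
    {G : Type*} [TopologicalSpace G] [ChartedSpace E G] [Group G] (g : G) : E →L[ℂ] E :=
  mfderiv 𝓘(ℂ, E) 𝓘(ℂ, E) (fun h : G => g * h * g⁻¹) 1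

/-- The derivative at `1` of the left translation by `g`. -/
def leftTranslation (E : Type*) [NormedAddCommGroup E] [NormedSpace ℂ E]
    {G : Type*} [TopologicalSpace G] [ChartedSpace E G] [Group G] (g : G) : E →L[ℂ] E :=
  mfderiv 𝓘(ℂ, E) 𝓘(ℂ, E) (fun h : G => g * h) 1

variable (G) in
theorem tendsto_chart_symm : Tendsto (extChartAt 𝓘(ℂ, E) (1 : G)).symm
    (𝓝 (extChartAt 𝓘(ℂ, E) (1 : G) 1)) (𝓝 1) := by
  have := continuousAt_extChartAt_symm (I := 𝓘(ℂ, E)) (1 : G)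
  rw [ContinuousAt, extChartAt_to_inv] at this
  exact this

variable [LieGroup 𝓘(ℂ, E) ω G]

theorem hasMFDerivAt_conj (g : G) :
    HasMFDerivAt 𝓘(ℂ, E) 𝓘(ℂ, E) (fun h : G => g * h * g⁻¹) 1 (Ad E g) := by
  have h : ContMDiff 𝓘(ℂ, E) 𝓘(ℂ, E) ω (fun h : G => g * h * g⁻¹) :=
    (contMDiff_mul_right (a := g⁻¹)).comp (contMDiff_mul_left (a := g))
  exact (h.mdifferentiableAt (by simp)).hasMFDerivAt

theorem hasMFDerivAt_mul_left (g : G) :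
    HasMFDerivAt 𝓘(ℂ, E) 𝓘(ℂ, E) (fun h : G => g * h) 1 (leftTranslation E g) := by
  have h : ContMDiff 𝓘(ℂ, E) 𝓘(ℂ, E) ω (fun h : G => g * h) := contMDiff_mul_left (a := g)
  exact (h.mdifferentiableAt (by simp)).hasMFDerivAt

theorem Ad_mul (g h : G) : Ad E (g * h) = (Ad E g).comp (Ad E h) := by
  have h1 : HasMFDerivAt 𝓘(ℂ, E) 𝓘(ℂ, E) (fun k : G => g * k * g⁻¹) (h * 1 * h⁻¹) (Ad E g) :=
    hasMFDerivAt_of_eq (hasMFDerivAt_conj g) (by simp)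
  have h2 : HasMFDerivAt 𝓘(ℂ, E) 𝓘(ℂ, E) (fun k : G => g * h * k * (g * h)⁻¹) 1
      ((Ad E g).comp (Ad E h)) := by
    have h3 := HasMFDerivAt.comp (1 : G) h1 (hasMFDerivAt_conj h)
    refine h3.congr_of_eventuallyEq (Eventually.of_forall fun k => ?_)
    simp [mul_assoc]
  exact hasMFDerivAt_unique (hasMFDerivAt_conj (g * h)) h2

theorem Ad_one : Ad E (1 : G) = ContinuousLinearMap.id ℂ E := by
  have h2 : HasMFDerivAt 𝓘(ℂ, E) 𝓘(ℂ, E) (fun k : G => 1 * k * 1⁻¹) 1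
      (ContinuousLinearMap.id ℂ E) :=
    (hasMFDerivAt_id (I := 𝓘(ℂ, E)) (1 : G)).congr_of_eventuallyEq
      (Eventually.of_forall fun k => by simp)
  exact hasMFDerivAt_unique (hasMFDerivAt_conj (1 : G)) h2

/-- The multiplication in the preferred chart at `1`. -/
def chartMul (E : Type*) [NormedAddCommGroup E] [NormedSpace ℂ E]
    (G : Type*) [TopologicalSpace G] [ChartedSpace E G] [Group G] (p : E × E) : E :=
  extChartAt 𝓘(ℂ, E) (1 : G)
    ((extChartAt 𝓘(ℂ, E) (1 : G)).symm p.1 * (extChartAt 𝓘(ℂ, E) (1 : G)).symm p.2)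

/-- The conjugation `(g, h) ↦ g h g⁻¹` in the preferred chart at `1`. -/
def chartConj (E : Type*) [NormedAddCommGroup E] [NormedSpace ℂ E]
    (G : Type*) [TopologicalSpace G] [ChartedSpace E G] [Group G] (p : E × E) : E :=
  extChartAt 𝓘(ℂ, E) (1 : G)
    ((extChartAt 𝓘(ℂ, E) (1 : G)).symm p.1 * (extChartAt 𝓘(ℂ, E) (1 : G)).symm p.2 *
      ((extChartAt 𝓘(ℂ, E) (1 : G)).symm p.1)⁻¹)

variable (G) in
theorem contMDiffAt_chart_symm : ContMDiffAt 𝓘(ℂ, E) 𝓘(ℂ, E) ω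
    (extChartAt 𝓘(ℂ, E) (1 : G)).symm (extChartAt 𝓘(ℂ, E) (1 : G) 1) :=
  (contMDiffOn_extChartAt_symm (1 : G)).contMDiffAt (extChartAt_target_mem_nhds (1 : G))

variable (G) in
theorem contDiffAt_chartMul : ContDiffAt ℂ ω (chartMul E G)
    (extChartAt 𝓘(ℂ, E) (1 : G) 1, extChartAt 𝓘(ℂ, E) (1 : G) 1) := by
  set x₀ := extChartAt 𝓘(ℂ, E) (1 : G) 1 with hx₀
  have hs := contMDiffAt_chart_symm (E := E) G
  have h1 : ContMDiffAt 𝓘(ℂ, E × E) 𝓘(ℂ, E) ω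
      (fun p : E × E => (extChartAt 𝓘(ℂ, E) (1 : G)).symm p.1) (x₀, x₀) :=
    ContMDiffAt.comp (x₀, x₀) hs contDiff_fst.contMDiff.contMDiffAt
  have h2 : ContMDiffAt 𝓘(ℂ, E × E) 𝓘(ℂ, E) ω
      (fun p : E × E => (extChartAt 𝓘(ℂ, E) (1 : G)).symm p.2) (x₀, x₀) :=
    ContMDiffAt.comp (x₀, x₀) hs contDiff_snd.contMDiff.contMDiffAt
  refine ContMDiffAt.contDiffAt (ContMDiffAt.comp (x₀, x₀) ?_ (h1.mul h2))
  refine contMDiffAt_extChartAt' ?_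
  simp [x₀]

variable (G) in
theorem contDiffAt_chartConj : ContDiffAt ℂ ω (chartConj E G)
    (extChartAt 𝓘(ℂ, E) (1 : G) 1, extChartAt 𝓘(ℂ, E) (1 : G) 1) := by
  set x₀ := extChartAt 𝓘(ℂ, E) (1 : G) 1 with hx₀
  have hs := contMDiffAt_chart_symm (E := E) G
  have h1 : ContMDiffAt 𝓘(ℂ, E × E) 𝓘(ℂ, E) ω
      (fun p : E × E => (extChartAt 𝓘(ℂ, E) (1 : G)).symm p.1) (x₀, x₀) :=
    ContMDiffAt.comp (x₀, x₀) hs contDiff_fst.contMDiff.contMDiffAt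
  have h2 : ContMDiffAt 𝓘(ℂ, E × E) 𝓘(ℂ, E) ω
      (fun p : E × E => (extChartAt 𝓘(ℂ, E) (1 : G)).symm p.2) (x₀, x₀) :=
    ContMDiffAt.comp (x₀, x₀) hs contDiff_snd.contMDiff.contMDiffAt
  refine ContMDiffAt.contDiffAt (ContMDiffAt.comp (x₀, x₀) ?_ ((h1.mul h2).mul h1.inv))
  refine contMDiffAt_extChartAt' ?_
  simp [x₀]

/-- The adjoint representation in the chart at `1`. -/
theorem Ad_chart_symm : ∀ᶠ x in 𝓝 (extChartAt 𝓘(ℂ, E) (1 : G) 1),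
    Ad E ((extChartAt 𝓘(ℂ, E) (1 : G)).symm x) =
      (fderiv ℂ (chartConj E G) (x, extChartAt 𝓘(ℂ, E) (1 : G) 1)).comp
        (ContinuousLinearMap.inr ℂ E E) := by
  set x₀ := extChartAt 𝓘(ℂ, E) (1 : G) 1 with hx₀
  have hd : ∀ᶠ p in 𝓝 (x₀, x₀), DifferentiableAt ℂ (chartConj E G) p :=
    (((contDiffAt_chartConj G).of_le le_top : ContDiffAt ℂ 1 _ _).eventually (by simp)).mono
      fun p hp => hp.differentiableAt one_ne_zero
  have hlc : Tendsto (fun x : E => (x, x₀)) (𝓝 x₀) (𝓝 (x₀, x₀)) :=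
    (Continuous.prodMk_left x₀).continuousAt
  filter_upwards [hlc.eventually hd] with x hx
  have h1 := hasFDerivAt_chart_of_hasMFDerivAt (y := 1) (hasMFDerivAt_conj (E := E)
    ((extChartAt 𝓘(ℂ, E) (1 : G)).symm x)) (by simp)
  exact h1.unique (hx.hasFDerivAt.comp x₀ (hasFDerivAt_prodMk_right x x₀))

/-- In the chart at `1`, the left-invariant vector field of `y` is the partial derivative of the
multiplication with respect to its second argument, in direction `y`. -/
theorem mpullback_mulInvariantVectorField_chart (y : GroupLieAlgebra 𝓘(ℂ, E) G) :
    ∀ᶠ x in 𝓝 (extChartAt 𝓘(ℂ, E) (1 : G) 1),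
      (VectorField.mpullbackWithin 𝓘(ℂ, E) 𝓘(ℂ, E) (extChartAt 𝓘(ℂ, E) (1 : G)).symm
        (mulInvariantVectorField y) (Set.range 𝓘(ℂ, E)) x : E) =
      (fderiv ℂ (chartMul E G) (x, extChartAt 𝓘(ℂ, E) (1 : G) 1)).comp
        (ContinuousLinearMap.inr ℂ E E) y := by
  set x₀ := extChartAt 𝓘(ℂ, E) (1 : G) 1 with hx₀
  have hd : ∀ᶠ p in 𝓝 (x₀, x₀), DifferentiableAt ℂ (chartMul E G) p :=
    (((contDiffAt_chartMul G).of_le le_top : ContDiffAt ℂ 1 _ _).eventually (by simp)).mono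
      fun p hp => hp.differentiableAt one_ne_zero
  have hlc : Tendsto (fun x : E => (x, x₀)) (𝓝 x₀) (𝓝 (x₀, x₀)) :=
    (Continuous.prodMk_left x₀).continuousAt
  filter_upwards [hlc.eventually hd, extChartAt_target_mem_nhds (I := 𝓘(ℂ, E)) (1 : G)]
    with x hx hxt
  set g := (extChartAt 𝓘(ℂ, E) (1 : G)).symm x with hg
  have hgs : g ∈ (extChartAt 𝓘(ℂ, E) (1 : G)).source :=
    (extChartAt 𝓘(ℂ, E) (1 : G)).map_target hxt
  have : IsManifold 𝓘(ℂ, E) 1 G := .of_le (n := ω) le_top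
  have hinv : (mfderivWithin 𝓘(ℂ, E) 𝓘(ℂ, E) (extChartAt 𝓘(ℂ, E) (1 : G)).symm
      (Set.range 𝓘(ℂ, E)) x).inverse = mfderiv 𝓘(ℂ, E) 𝓘(ℂ, E) (extChartAt 𝓘(ℂ, E) (1 : G)) g :=
    ContinuousLinearMap.inverse_eq
      (mfderivWithin_extChartAt_symm_comp_mfderiv_extChartAt hxt)
      (mfderiv_extChartAt_comp_mfderivWithin_extChartAt_symm hxt)
  rw [VectorField.mpullbackWithin_apply, hinv]
  have h1 : HasMFDerivAt 𝓘(ℂ, E) 𝓘(ℂ, E) (extChartAt 𝓘(ℂ, E) (1 : G)) g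
      (mfderiv 𝓘(ℂ, E) 𝓘(ℂ, E) (extChartAt 𝓘(ℂ, E) (1 : G)) g) :=
    (mdifferentiableAt_extChartAt (by simpa using hgs)).hasMFDerivAt
  have h2 := HasMFDerivAt.comp (1 : G) (hasMFDerivAt_of_eq h1 (mul_one g).symm)
    (hasMFDerivAt_mul_left g)
  have h3 := hasFDerivAt_chart_of_hasMFDerivAt h2 rfl
  have h4 := h3.unique (hx.hasFDerivAt.comp x₀ (hasFDerivAt_prodMk_right x x₀))
  exact congrArg (fun T : E →L[ℂ] E => T y) h4

/-- The derivative of the adjoint representation at `1` is `ad`, for the bracket of left-invariant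
vector fields. -/
theorem hasMFDerivAt_Ad_one : ∃ D : E →L[ℂ] E →L[ℂ] E,
    HasMFDerivAt 𝓘(ℂ, E) 𝓘(ℂ, E →L[ℂ] E) (Ad E : G → E →L[ℂ] E) 1 D ∧
      ∀ X y : GroupLieAlgebra 𝓘(ℂ, E) G, D X y = ⁅X, y⁆ := by
  have : IsManifold 𝓘(ℂ, E) 1 G := .of_le (n := ω) le_top
  set e := extChartAt 𝓘(ℂ, E) (1 : G) with he
  set x₀ := e 1 with hx₀
  have hs1 : e.symm (e 1) = 1 := extChartAt_to_inv (I := 𝓘(ℂ, E)) (1 : G)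
  have hκ := contDiffAt_chartConj (E := E) G
  have hμ := contDiffAt_chartMul (E := E) G
  have hst := tendsto_chart_symm (E := E) G
  have hright : ∀ᶠ x in 𝓝 x₀, e (e.symm x) = x := by
    filter_upwards [extChartAt_target_mem_nhds (I := 𝓘(ℂ, E)) (1 : G)] with z hz
    exact e.right_inv hz
  have hleft : ∀ᶠ g in 𝓝 (1 : G), e.symm (e g) = g := by
    filter_upwards [extChartAt_source_mem_nhds (I := 𝓘(ℂ, E)) (1 : G)] with z hz
    exact e.left_inv hz
  set K : E → E →L[ℂ] E := fun x =>
    (fderiv ℂ (chartConj E G) (x, x₀)).comp (ContinuousLinearMap.inr ℂ E E) with hKdef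
  set B : E → E →L[ℂ] E := fun x =>
    (fderiv ℂ (chartMul E G) (x, x₀)).comp (ContinuousLinearMap.inr ℂ E E) with hBdef
  have hl : DifferentiableAt ℂ (fun x : E => (x, x₀)) x₀ :=
    (hasFDerivAt_prodMk_left x₀ x₀).differentiableAt
  have hK : DifferentiableAt ℂ K x₀ := by
    have h1 : DifferentiableAt ℂ (fderiv ℂ (chartConj E G)) (x₀, x₀) :=
      (hκ.fderiv_right (m := 1) le_top).differentiableAt one_ne_zero
    exact (DifferentiableAt.comp (f := fun x : E => (x, x₀)) x₀ h1 hl).clm_comp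
      (differentiableAt_const _)
  have hB : DifferentiableAt ℂ B x₀ := by
    have h1 : DifferentiableAt ℂ (fderiv ℂ (chartMul E G)) (x₀, x₀) :=
      (hμ.fderiv_right (m := 1) le_top).differentiableAt one_ne_zero
    exact (DifferentiableAt.comp (f := fun x : E => (x, x₀)) x₀ h1 hl).clm_comp
      (differentiableAt_const _)
  refine ⟨fderiv ℂ K x₀, ?_, fun X y => ?_⟩
  · have h1 : HasMFDerivAt 𝓘(ℂ, E) 𝓘(ℂ, E →L[ℂ] E) (K ∘ e) 1 (fderiv ℂ K x₀) :=
      HasMFDerivAt.comp (1 : G) hK.hasFDerivAt.hasMFDerivAt (hasMFDerivAt_extChartAt_self (1 : G))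
    refine h1.congr_of_eventuallyEq ?_
    filter_upwards [hleft, (continuousAt_extChartAt (I := 𝓘(ℂ, E)) (1 : G)).tendsto.eventually
      (Ad_chart_symm (E := E) (G := G))] with g hg1 hg2
    rw [← he, hg1] at hg2
    exact hg2
  · have hB₀ : B x₀ = ContinuousLinearMap.id ℂ E := by
      have h1 : DifferentiableAt ℂ (chartMul E G) (x₀, x₀) :=
        (hμ.of_le le_top : ContDiffAt ℂ 1 _ _).differentiableAt one_ne_zero
      refine (h1.hasFDerivAt.comp x₀ (hasFDerivAt_prodMk_right x₀ x₀)).unique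
        ((hasFDerivAt_id x₀).congr_of_eventuallyEq ?_)
      filter_upwards [hright] with x hx
      simp only [Function.comp_apply, chartMul, hx₀, ← he, hs1, one_mul, hx, id]
    have hbr : ((⁅X, y⁆ : GroupLieAlgebra 𝓘(ℂ, E) G) : E) =
        fderiv ℂ B x₀ X y - fderiv ℂ B x₀ y X := by
      rw [GroupLieAlgebra.bracket_def, ← VectorField.mlieBracketWithin_univ,
        VectorField.mlieBracketWithin_apply]
      have hinv : ContinuousLinearMap.inverse
          (mfderiv 𝓘(ℂ, E) 𝓘(ℂ, E) (extChartAt 𝓘(ℂ, E) (1 : G)) 1 : E →L[ℂ] E) =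
          ContinuousLinearMap.id ℂ E :=
        @inverse_eq_id E _ _ _ mfderiv_extChartAt_self
      refine (congrArg (fun T : E →L[ℂ] E => T _) hinv).trans ?_
      have hW := mpullback_mulInvariantVectorField_chart (E := E) (G := G)
      have hset : e.symm ⁻¹' Set.univ ∩ Set.range 𝓘(ℂ, E) = Set.univ := by simp
      rw [hset]
      have hXy := lieBracketWithin_univ_eq_of_eventuallyEq (E := E) (X := X) (y := y) hB hB₀
        (hW X) (hW y)
      exact hXy
    refine Eq.trans ?_ hbr.symm
    refine fderiv_conjugation_eq_bracket (hμ.of_le le_top) (hκ.of_le le_top) ?_ ?_ ?_ ?_ X y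
    · filter_upwards [hright] with x hx
      simp only [chartMul, ← he, hs1, mul_one, hx]
    · refine Eventually.of_forall fun x => ?_
      simp only [chartConj, ← he, hs1, mul_one, mul_inv_cancel]
    · filter_upwards [hright] with x hx
      simp only [chartConj, ← he, hs1, one_mul, inv_one, mul_one, hx]
    · have h1 : Tendsto (fun p : E × E => e.symm p.1 * e.symm p.2 * (e.symm p.1)⁻¹)
          (𝓝 (x₀, x₀)) (𝓝 1) := by
        have : IsTopologicalGroup G := topologicalGroup_of_lieGroup 𝓘(ℂ, E) ω
        have a1 : Tendsto (fun p : E × E => e.symm p.1) (𝓝 (x₀, x₀)) (𝓝 1) :=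
          hst.comp continuous_fst.continuousAt
        have a2 : Tendsto (fun p : E × E => e.symm p.2) (𝓝 (x₀, x₀)) (𝓝 1) :=
          hst.comp continuous_snd.continuousAt
        simpa using (a1.mul a2).mul a1.inv
      filter_upwards [h1.eventually hleft] with p hp
      simp only [chartMul, chartConj, ← he, hp, inv_mul_cancel_right]

end Adjoint

/-! ### Left-invariant vector fields and their integral curves -/

section Curves

variable {E : Type*} [NormedAddCommGroup E] [NormedSpace ℂ E]
  {G : Type*} [TopologicalSpace G] [ChartedSpace E G] [Group G] [LieGroup 𝓘(ℂ, E) ω G]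

theorem hasMFDerivAt_maurerCartan (g : G) :
    HasMFDerivAt 𝓘(ℂ, E) 𝓘(ℂ, E) (fun h : G => g⁻¹ * h) g (maurerCartan (E := E) g) := by
  have h : ContMDiff 𝓘(ℂ, E) 𝓘(ℂ, E) ω (fun h : G => g⁻¹ * h) := contMDiff_mul_left (a := g⁻¹)
  exact (h.mdifferentiableAt (by simp)).hasMFDerivAt

theorem leftTranslation_mul (g h : G) {T : E →L[ℂ] E}
    (hT : HasMFDerivAt 𝓘(ℂ, E) 𝓘(ℂ, E) (fun k : G => g * k) h T) :
    leftTranslation E (g * h) = T.comp (leftTranslation E h) := by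
  have h1 := HasMFDerivAt.comp (1 : G) (hasMFDerivAt_of_eq hT (mul_one h).symm)
    (hasMFDerivAt_mul_left (E := E) h)
  have h2 : HasMFDerivAt 𝓘(ℂ, E) 𝓘(ℂ, E) (fun k : G => g * h * k) 1
      (T.comp (leftTranslation E h)) :=
    h1.congr_of_eventuallyEq (Eventually.of_forall fun k => by simp [mul_assoc])
  exact hasMFDerivAt_unique (hasMFDerivAt_mul_left (g * h)) h2

theorem leftTranslation_one : leftTranslation E (1 : G) = ContinuousLinearMap.id ℂ E := by
  have h2 : HasMFDerivAt 𝓘(ℂ, E) 𝓘(ℂ, E) (fun k : G => 1 * k) 1 (ContinuousLinearMap.id ℂ E) :=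
    (hasMFDerivAt_id (I := 𝓘(ℂ, E)) (1 : G)).congr_of_eventuallyEq
      (Eventually.of_forall fun k => by simp)
  exact hasMFDerivAt_unique (hasMFDerivAt_mul_left (1 : G)) h2

theorem maurerCartan_leftTranslation (g : G) (X : E) :
    (maurerCartan (E := E) g : E →L[ℂ] E) (leftTranslation E g X) = X := by
  have h := leftTranslation_mul g⁻¹ g (hasMFDerivAt_maurerCartan (E := E) g)
  rw [inv_mul_cancel, leftTranslation_one] at h
  exact (congrArg (fun T : E →L[ℂ] E => T X) h).symm

theorem leftTranslation_maurerCartan (g : G) (v : E) :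
    leftTranslation E g ((maurerCartan (E := E) g : E →L[ℂ] E) v) = v := by
  have h1 : HasMFDerivAt 𝓘(ℂ, E) 𝓘(ℂ, E) (fun k : G => g * k) (g⁻¹ * g) (leftTranslation E g) :=
    hasMFDerivAt_of_eq (hasMFDerivAt_mul_left g) (by simp)
  have h2 := HasMFDerivAt.comp g h1 (hasMFDerivAt_maurerCartan (E := E) g)
  have h3 : HasMFDerivAt 𝓘(ℂ, E) 𝓘(ℂ, E) ((fun k : G => g * k) ∘ fun k => g⁻¹ * k) g
      (ContinuousLinearMap.id ℂ E) :=
    (hasMFDerivAt_id (I := 𝓘(ℂ, E)) g).congr_of_eventuallyEq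
      (Eventually.of_forall fun k => by simp)
  exact congrArg (fun T : E →L[ℂ] E => T v) (hasMFDerivAt_unique h2 h3)

/-- The adjoint representation is holomorphic, and its derivative along the left-invariant field
of `X` at `g` is `Ad g ∘ ad X`. -/
theorem exists_hasMFDerivAt_Ad (g : G) : ∃ T : E →L[ℂ] E →L[ℂ] E,
    HasMFDerivAt 𝓘(ℂ, E) 𝓘(ℂ, E →L[ℂ] E) (Ad E : G → E →L[ℂ] E) g T ∧
      ∀ X y : GroupLieAlgebra 𝓘(ℂ, E) G,
        T (leftTranslation E g X) y = Ad E g (⁅X, y⁆ : GroupLieAlgebra 𝓘(ℂ, E) G) := by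
  obtain ⟨D, hD, hDbr⟩ := hasMFDerivAt_Ad_one (E := E) (G := G)
  refine ⟨((ContinuousLinearMap.compL ℂ E E E (Ad E g)).comp D).comp (maurerCartan (E := E) g), ?_,
    fun X y => ?_⟩
  · have h1 := HasMFDerivAt.comp g (hasMFDerivAt_of_eq hD (inv_mul_cancel g).symm)
      (hasMFDerivAt_maurerCartan (E := E) g)
    have h2 := HasMFDerivAt.comp g
      (ContinuousLinearMap.compL ℂ E E E (Ad E g)).hasFDerivAt.hasMFDerivAt h1
    refine h2.congr_of_eventuallyEq (Eventually.of_forall fun k => ?_)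
    simp [← Ad_mul]
  · have h := maurerCartan_leftTranslation (E := E) g X
    change Ad E g (D ((maurerCartan (E := E) g : E →L[ℂ] E) (leftTranslation E g X)) y) = _
    exact (congrArg (fun z : E => Ad E g (D z y)) h).trans (congrArg (Ad E g) (hDbr X y))

/-- The left-invariant vector field of `X`, as a field on the real manifold underlying `G`. -/
def leftInvariantField (X : E) (h : G) : TangentSpace 𝓘(ℝ, E) h := leftTranslation E h X

theorem contMDiff_leftInvariantField [IsManifold 𝓘(ℝ, E) 1 G] (X : E) :
    ContMDiff 𝓘(ℝ, E) (𝓘(ℝ, E).prod 𝓘(ℝ, E)) 1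
      (fun h : G => (⟨h, leftInvariantField X h⟩ : TangentBundle 𝓘(ℝ, E) G)) := by
  have : LieGroup 𝓘(ℝ, E) ω G := lieGroup_restrictScalars ω
  have : LieGroup 𝓘(ℝ, E) (minSmoothness ℝ 3) G := .of_le (n := ω) le_top
  have h := contMDiff_mulInvariantVectorField (I := 𝓘(ℝ, E)) (G := G) X
  have h2 : (leftInvariantField X : (h : G) → TangentSpace 𝓘(ℝ, E) h) =
      mulInvariantVectorField (I := 𝓘(ℝ, E)) X := by
    funext g
    have := (hasMFDerivAt_restrictScalars (hasMFDerivAt_mul_left (E := E) g)).mfderiv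
    exact (congrArg (fun T : E →L[ℝ] E => T X) this).symm
  rw [h2]
  exact h.of_le (by simp)

/-- Left translates of integral curves of left-invariant vector fields are integral curves. -/
theorem hasMFDerivAt_mul_left_curve {γ : ℝ → G} {t : ℝ} {X : E} (g : G)
    (h : HasMFDerivAt 𝓘(ℝ, ℝ) 𝓘(ℝ, E) γ t
      ((1 : ℝ →L[ℝ] ℝ).smulRight (leftTranslation E (γ t) X) : ℝ →L[ℝ] E)) :
    HasMFDerivAt 𝓘(ℝ, ℝ) 𝓘(ℝ, E) (fun s => g * γ s) t
      ((1 : ℝ →L[ℝ] ℝ).smulRight (leftTranslation E (g * γ t) X) : ℝ →L[ℝ] E) := by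
  have hT : HasMFDerivAt 𝓘(ℂ, E) 𝓘(ℂ, E) (fun k : G => g * k) (γ t) _ :=
    ((contMDiff_mul_left (I := 𝓘(ℂ, E)) (n := ω) (a := g)).mdifferentiableAt (by simp)).hasMFDerivAt
  have h1 := HasMFDerivAt.comp t (hasMFDerivAt_restrictScalars hT) h
  rw [leftTranslation_mul g (γ t) hT]
  refine h1.congr_mfderiv ?_
  exact ContinuousLinearMap.ext fun s : ℝ =>
    ContinuousLinearMap.map_smul_of_tower (mfderiv 𝓘(ℂ, E) 𝓘(ℂ, E) (fun k : G => g * k) (γ t) :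
      E →L[ℂ] E) s _

variable [CompleteSpace E] [T2Space G]

/-- Left-invariant vector fields are complete: by left translation, the interval on which the
integral curve through `1` exists serves for every initial point. -/
theorem exists_integralCurve (X : E) : ∃ γ : ℝ → G, γ 0 = 1 ∧
    IsMIntegralCurve (I := 𝓘(ℝ, E)) γ (leftInvariantField X) := by
  have : IsManifold 𝓘(ℂ, E) 1 G := .of_le (n := ω) le_top
  have : IsManifold 𝓘(ℝ, E) 1 G := isManifold_restrictScalars 1
  have hv := contMDiff_leftInvariantField (G := G) X
  obtain ⟨γ, hγ₀, hγ⟩ := exists_isMIntegralCurveAt_of_contMDiffAt_boundaryless 0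
    (hv.contMDiffAt (x := 1))
  obtain ⟨ε, hε, hball⟩ := Metric.eventually_nhds_iff_ball.1 hγ
  refine exists_isMIntegralCurve_of_isMIntegralCurveOn hv hε (fun x => ?_) 1
  refine ⟨fun s => x * γ s, by simp [hγ₀], fun t ht => ?_⟩
  refine HasMFDerivAt.hasMFDerivWithinAt ?_
  refine hasMFDerivAt_mul_left_curve x (hball t ?_)
  rwa [Real.ball_eq_Ioo, zero_sub, zero_add]

end Curves

/-! ### Invariance of a subalgebra under its connected subgroup -/

section Subgroups

variable {E : Type*} [NormedAddCommGroup E] [NormedSpace ℂ E] [FiniteDimensional ℂ E]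
  {G : Type*} [TopologicalSpace G] [ChartedSpace E G] [Group G] [LieGroup 𝓘(ℂ, E) ω G]

/-- A projection onto a subspace of a finite-dimensional space. -/
theorem exists_continuousLinearMap_projection (W : Submodule ℂ E) :
    ∃ P : E →L[ℂ] W, ∀ w : W, P w = w := by
  obtain ⟨P, hP⟩ := W.subtype.exists_leftInverse_of_injective W.ker_subtype
  exact ⟨LinearMap.toContinuousLinearMap P, fun w => LinearMap.congr_fun hP w⟩

theorem hasDerivAt_clm_comp {V W : Type*} [NormedAddCommGroup V] [NormedSpace ℂ V]
    [NormedAddCommGroup W] [NormedSpace ℂ W] (L : V →L[ℂ] W) {c : ℝ → V} {c' : V} {t : ℝ}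
    (hc : HasDerivAt c c' t) : HasDerivAt (fun s => L (c s)) (L c') t :=
  (L.restrictScalars ℝ).hasFDerivAt.comp_hasDerivAt t hc

/-- If a curve of operators solves `c' = c ∘ A`, starts at the identity, and `A` preserves `W`, then
the curve preserves `W`: modulo `W`, the restriction of `c` to `W` solves a linear equation
with zero initial value. -/
theorem mem_of_hasDerivAt_comp {W : Submodule ℂ E} {A : E →L[ℂ] E} (hA : ∀ w ∈ W, A w ∈ W)
    {c : ℝ → E →L[ℂ] E} (hc : ∀ t, HasDerivAt c ((c t).comp A) t)
    (hc₀ : c 0 = ContinuousLinearMap.id ℂ E) (t : ℝ) {w : E} (hw : w ∈ W) : c t w ∈ W := by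
  obtain ⟨P, hP⟩ := exists_continuousLinearMap_projection W
  -- `R` vanishes exactly on `W`
  set R : E →L[ℂ] E := ContinuousLinearMap.id ℂ E - W.subtypeL.comp P with hR
  have hRW : ∀ v ∈ W, R v = 0 := fun v hv => by
    have := hP ⟨v, hv⟩
    simp [hR, this]
  have hRmem : ∀ v, R v = 0 → v ∈ W := fun v hv => by
    have h1 : v = W.subtypeL (P v) := sub_eq_zero.1 hv
    rw [h1]
    exact (P v).2
  set Q : E →L[ℂ] E := W.subtypeL.comp P with hQ
  have hQW : ∀ v ∈ W, Q v = v := fun v hv => congrArg Subtype.val (hP ⟨v, hv⟩)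
  set d : ℝ → E →L[ℂ] E := fun s => R.comp ((c s).comp Q) with hd
  set Λ : (E →L[ℂ] E) →L[ℂ] (E →L[ℂ] E) :=
    (ContinuousLinearMap.compL ℂ E E E).flip (A.comp Q) with hΛ
  have hd' : ∀ s, HasDerivAt d (Λ (d s)) s := fun s => by
    have h1 := hasDerivAt_clm_comp ((ContinuousLinearMap.compL ℂ E E E R).comp
      ((ContinuousLinearMap.compL ℂ E E E).flip Q)) (hc s)
    refine h1.congr_deriv (ContinuousLinearMap.ext fun v => ?_)
    change R (c s (A (Q v))) = R (c s (Q (A (Q v))))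
    have hv : Q (A (Q v)) = A (Q v) := hQW _ (hA _ (P v).2)
    rw [hv]
  have hzero : d = fun _ => 0 := by
    refine ODE_solution_unique_univ (v := fun _ => Λ) (s := fun _ => Set.univ) (K := ‖Λ‖₊)
      (t₀ := 0) (fun _ => Λ.lipschitz.lipschitzOnWith) (fun s => ⟨hd' s, Set.mem_univ _⟩)
      (fun s => ⟨?_, Set.mem_univ _⟩) ?_
    · simpa using hasDerivAt_const s (0 : E →L[ℂ] E)
    · ext v
      simp only [hd, hc₀]
      exact hRW _ (P v).2
  have h1 := congrArg (fun T : E →L[ℂ] E => T w) (congrFun hzero t)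
  have h2 : R (c t (Q w)) = 0 := h1
  rw [hQW w hw] at h2
  exact hRmem _ h2

/-- `Ad (exp X)` preserves `𝔥` for `X ∈ 𝔥`, since `c t = Ad (exp (t X))` solves
`c' = c ∘ ad X`. -/
theorem Ad_mem_of_isExp {𝔥 : LieSubalgebra ℂ (GroupLieAlgebra 𝓘(ℂ, E) G)}
    {X : GroupLieAlgebra 𝓘(ℂ, E) G} (hX : X ∈ 𝔥) {g : G} (hg : IsExp X g)
    {y : GroupLieAlgebra 𝓘(ℂ, E) G} (hy : y ∈ 𝔥) :
    (Ad E g y : GroupLieAlgebra 𝓘(ℂ, E) G) ∈ 𝔥 := by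
  obtain ⟨γ, hγ₀, rfl, hγ⟩ := hg
  obtain ⟨D, -, hD⟩ := hasMFDerivAt_Ad_one (E := E) (G := G)
  refine mem_of_hasDerivAt_comp (E := E) (W := 𝔥.toSubmodule) (A := D X) (c := fun t => Ad E (γ t))
    (fun w hw => ?_) (fun t => ?_) ?_ 1 hy
  · have := 𝔥.lie_mem hX hw
    rw [← hD X w] at this
    exact this
  · obtain ⟨T, hT, hTbr⟩ := exists_hasMFDerivAt_Ad (E := E) (γ t)
    refine (hasDerivAt_comp_curve (hγ t) hT).congr_deriv ?_
    exact ContinuousLinearMap.ext fun y =>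
      (hTbr X y).trans (congrArg (Ad E (γ t)) (hD X y).symm)
  · simp only [hγ₀, Ad_one]

theorem Ad_mem_of_mem_connectedSubgroup {𝔥 : LieSubalgebra ℂ (GroupLieAlgebra 𝓘(ℂ, E) G)}
    {h : G} (hh : h ∈ connectedSubgroup 𝔥) {y : GroupLieAlgebra 𝓘(ℂ, E) G} (hy : y ∈ 𝔥) :
    (Ad E h y : GroupLieAlgebra 𝓘(ℂ, E) G) ∈ 𝔥 := by
  induction hh using Subgroup.closure_induction generalizing y with
  | mem g hg => exact Ad_mem_of_isExp hg.choose_spec.1 hg.choose_spec.2 hy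
  | one => rw [Ad_one]; exact hy
  | mul g k _ _ hg hk => rw [Ad_mul]; exact hg (hk hy)
  | inv g _ hg =>
    -- `Ad g` is injective on the finite-dimensional space `𝔥`, hence onto
    let W : Submodule ℂ E := 𝔥.toSubmodule
    let f : W →ₗ[ℂ] W := (Ad E g : E →ₗ[ℂ] E).restrict fun z hz => hg hz
    have hinj : Function.Injective f := by
      intro a b hab
      have h1 : Ad E g (a : E) = Ad E g (b : E) := congrArg Subtype.val hab
      have h2 := congrArg (Ad E g⁻¹) h1
      rw [← ContinuousLinearMap.comp_apply, ← ContinuousLinearMap.comp_apply, ← Ad_mul,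
        inv_mul_cancel, Ad_one] at h2
      exact Subtype.ext h2
    obtain ⟨z, hz⟩ := LinearMap.surjective_of_injective hinj ⟨y, hy⟩
    have h1 : Ad E g (z : E) = y := congrArg Subtype.val hz
    have h2 : Ad E g⁻¹ y = (z : E) := by
      rw [← h1, ← ContinuousLinearMap.comp_apply, ← Ad_mul, inv_mul_cancel, Ad_one]
      rfl
    rw [h2]
    exact z.2

end Subgroups

/-! ### Graph coordinates on the Grassmannian -/

section Graph

variable {R : Type*} [NormedRing R]

/-- The compression of `c` to the range of the projection `Q`, extended by the identity on the kernel
of `Q`, so that its inverse can be taken in the whole algebra. -/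
def graphDenominator (Q c : R) : R := Q * c * Q + (1 - Q)

/-- If `Q` is a projection onto `W` and `c` an operator, `graphMap Q c` describes the subspace `c W`
as a graph over `W`: on `W` it is the inverse of the compression of `c` to `W`, followed by `c`. If
the compression is not invertible, its value is `0`. -/
def graphMap (Q c : R) : R := c * Q * Ring.inverse (graphDenominator Q c)

/-- An operator `a` which preserves the range of `Q` changes the denominator by a factor. -/
theorem graphDenominator_mul {Q a : R} (hQ : Q * Q = Q) (ha : Q * a * Q = a * Q) (c : R) :
    graphDenominator Q (c * a) = graphDenominator Q c * (a * Q + (1 - Q)) := by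
  have h1 : Q * (1 - Q) = 0 := by rw [mul_sub, mul_one, hQ, sub_self]
  have h2 : (1 - Q) * a * Q = 0 := by rw [sub_mul, sub_mul, one_mul, ha, sub_self]
  have h3 : (1 - Q) * (1 - Q) = 1 - Q := by rw [sub_mul, one_mul, h1, sub_zero]
  calc graphDenominator Q (c * a) = Q * c * (a * Q) + (1 - Q) := by
        simp only [graphDenominator, mul_assoc]
    _ = Q * c * (Q * a * Q) + (1 - Q) := by rw [ha]
    _ = Q * c * (Q * a * Q) + Q * c * (Q * (1 - Q)) + ((1 - Q) * a * Q + (1 - Q) * (1 - Q)) := by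
        rw [h1, h2, h3, mul_zero, add_zero, zero_add]
    _ = graphDenominator Q c * (a * Q + (1 - Q)) := by
        simp only [graphDenominator, mul_assoc, add_mul, mul_add]
        abel

theorem mul_add_one_sub_eq_one {Q a a' : R} (hQ : Q * Q = Q) (ha' : Q * a' * Q = a' * Q)
    (haa' : a * a' = 1) : (a * Q + (1 - Q)) * (a' * Q + (1 - Q)) = 1 := by
  have h1 : Q * (1 - Q) = 0 := by rw [mul_sub, mul_one, hQ, sub_self]
  have h2 : (1 - Q) * (a' * Q) = 0 := by rw [sub_mul, one_mul, ← mul_assoc, ha', sub_self]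
  have h3 : (1 - Q) * (1 - Q) = 1 - Q := by rw [sub_mul, one_mul, h1, sub_zero]
  have h4 : a * Q * (a' * Q) = Q := by
    rw [mul_assoc, ← mul_assoc Q, ha', ← mul_assoc, haa', one_mul]
  rw [add_mul, mul_add, mul_add, h2, h3, h4, mul_assoc a, h1, mul_zero]
  abel

theorem isUnit_mul_add_one_sub {Q a a' : R} (hQ : Q * Q = Q) (ha : Q * a * Q = a * Q)
    (ha' : Q * a' * Q = a' * Q) (h1 : a * a' = 1) (h2 : a' * a = 1) :
    IsUnit (a * Q + (1 - Q)) :=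
  ⟨⟨_, _, mul_add_one_sub_eq_one hQ ha' h1, mul_add_one_sub_eq_one hQ ha h2⟩, rfl⟩

theorem isUnit_graphDenominator_mul {Q a a' : R} (hQ : Q * Q = Q) (ha : Q * a * Q = a * Q)
    (ha' : Q * a' * Q = a' * Q) (h1 : a * a' = 1) (h2 : a' * a = 1) (c : R) :
    IsUnit (graphDenominator Q (c * a)) ↔ IsUnit (graphDenominator Q c) := by
  rw [graphDenominator_mul hQ ha]
  exact (isUnit_mul_add_one_sub hQ ha ha' h1 h2).mul_right_iff

/-- The graph depends on the subspace `c W` only: it is unchanged if `c` is multiplied by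
an automorphism `a` of `W`. -/
theorem graphMap_mul {Q a a' : R} (hQ : Q * Q = Q) (ha : Q * a * Q = a * Q)
    (ha' : Q * a' * Q = a' * Q) (h1 : a * a' = 1) (h2 : a' * a = 1) (c : R) :
    graphMap Q (c * a) = graphMap Q c := by
  by_cases hc : IsUnit (graphDenominator Q c)
  · obtain ⟨u, hu⟩ := hc
    obtain ⟨v, hv⟩ := isUnit_mul_add_one_sub hQ ha ha' h1 h2
    have hQv : c * a * Q = c * Q * v := by
      rw [hv, mul_add, mul_assoc c Q (1 - Q), mul_sub, mul_one, hQ, sub_self, mul_zero, add_zero,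
        mul_assoc, ← ha]
      simp only [mul_assoc]
      rw [← mul_assoc Q Q, hQ]
    rw [graphMap, graphMap, graphDenominator_mul hQ ha, ← hu, ← hv, ← Units.val_mul,
      Ring.inverse_unit, Ring.inverse_unit, mul_inv_rev, Units.val_mul, hQv, mul_assoc (c * Q),
      Units.mul_inv_cancel_left]
  · have hca := mt (isUnit_graphDenominator_mul hQ ha ha' h1 h2 c).1 hc
    rw [graphMap, graphMap, Ring.inverse_non_unit _ hc, Ring.inverse_non_unit _ hca, mul_zero,
      mul_zero]

theorem graphDenominator_one {Q : R} (hQ : Q * Q = Q) : graphDenominator Q 1 = 1 := by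
  rw [graphDenominator, mul_one, hQ, add_sub_cancel]

variable [NormedAlgebra ℂ R]

theorem hasFDerivAt_graphDenominator (Q c : R) :
    HasFDerivAt (graphDenominator Q) (ContinuousLinearMap.mulLeftRight ℂ R Q Q) c :=
  (ContinuousLinearMap.mulLeftRight ℂ R Q Q).hasFDerivAt.add_const (1 - Q)

variable [CompleteSpace R]

theorem differentiableAt_graphMap {Q c : R} (h : IsUnit (graphDenominator Q c)) :
    DifferentiableAt ℂ (graphMap Q) c := by
  have h1 : DifferentiableAt ℂ (Ring.inverse : R → R) (graphDenominator Q c) := by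
    obtain ⟨u, hu⟩ := h
    rw [← hu]
    exact (hasFDerivAt_ringInverse (𝕜 := ℂ) u).differentiableAt
  exact (differentiableAt_id.mul_const Q).mul
    (h1.comp c (hasFDerivAt_graphDenominator Q c).differentiableAt)

theorem fderiv_graphMap_one {Q : R} (hQ : Q * Q = Q) (c : R) :
    fderiv ℂ (graphMap Q) 1 c = c * Q - Q * c * Q := by
  have h0 : HasFDerivAt (Ring.inverse : R → R) (-ContinuousLinearMap.mulLeftRight ℂ R 1 1)
      (graphDenominator Q 1) := by
    rw [graphDenominator_one hQ]
    simpa using hasFDerivAt_ringInverse (𝕜 := ℂ) (1 : Rˣ)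
  have h1 := ((hasFDerivAt_id (𝕜 := ℂ) (1 : R)).mul_const' Q).mul'
    (h0.comp 1 (hasFDerivAt_graphDenominator Q 1))
  have h2 : HasFDerivAt (graphMap Q) _ (1 : R) := h1
  rw [h2.fderiv]
  simp [graphDenominator_one hQ, ← mul_assoc, hQ]
  abel

end Graph

/-! ### Local holomorphic functions on a homogeneous space -/

section LocalFunctions

variable {E : Type*} [NormedAddCommGroup E] [NormedSpace ℂ E] [FiniteDimensional ℂ E]
  {G : Type*} [TopologicalSpace G] [ChartedSpace E G] [Group G] [LieGroup 𝓘(ℂ, E) ω G]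

/-- The homogeneous space of a self-normalizing subalgebra `𝔥` has enough local holomorphic
functions: they separate the tangent directions transversal to `𝔥`. They are the matrix
coefficients of `Ad g` acting on the Grassmannian near `𝔥`. -/
theorem exists_holomorphicFun {𝔥 : LieSubalgebra ℂ (GroupLieAlgebra 𝓘(ℂ, E) G)}
    {X : GroupLieAlgebra 𝓘(ℂ, E) G} (hX : ¬ ∀ y ∈ 𝔥, ⁅X, y⁆ ∈ 𝔥) (g₀ : G) :
    ∃ (U : Set (G ⧸ connectedSubgroup 𝔥)) (f : G ⧸ connectedSubgroup 𝔥 → ℂ) (A : E →L[ℂ] ℂ),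
      IsOpen U ∧ QuotientGroup.mk g₀ ∈ U ∧ IsHolomorphicFunOn E f U ∧
      HasMFDerivAt 𝓘(ℂ, E) 𝓘(ℂ) (fun g : G => f (QuotientGroup.mk g)) g₀ A ∧
      A (leftTranslation E g₀ X) ≠ 0 := by
  have : CompleteSpace E := FiniteDimensional.complete ℂ E
  have : IsTopologicalGroup G := topologicalGroup_of_lieGroup 𝓘(ℂ, E) ω
  push Not at hX
  obtain ⟨y, hy, hXy⟩ := hX
  let W : Submodule ℂ E := 𝔥.toSubmodule
  obtain ⟨P, hP⟩ := exists_continuousLinearMap_projection W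
  set Q : E →L[ℂ] E := W.subtypeL.comp P with hQdef
  have hQW : ∀ v ∈ W, Q v = v := fun v hv => congrArg Subtype.val (hP ⟨v, hv⟩)
  have hQmem : ∀ v, Q v ∈ W := fun v => (P v).2
  have hQ : Q * Q = Q := ContinuousLinearMap.ext fun v => hQW _ (hQmem v)
  obtain ⟨D, hD, hDbr⟩ := hasMFDerivAt_Ad_one (E := E) (G := G)
  -- the covector which detects the class of `⁅X, y⁆` modulo `𝔥`
  obtain ⟨ξ, hξ⟩ : ∃ ξ : E →L[ℂ] ℂ, ξ (D X y - Q (D X y)) ≠ 0 := by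
    refine SeparatingDual.exists_ne_zero fun h0 => hXy ?_
    have h1 : D X y ∈ W := by
      rw [sub_eq_zero.1 h0]
      exact hQmem _
    rw [hDbr] at h1
    exact h1
  set H := connectedSubgroup 𝔥 with hH
  have hAd : ∀ h ∈ H, Q * Ad E h * Q = Ad E h * Q := fun h hh =>
    ContinuousLinearMap.ext fun v => hQW _ (Ad_mem_of_mem_connectedSubgroup hh (hQmem v))
  have hAdmul : ∀ g h : G, Ad E g * Ad E h = Ad E (g * h) := fun g h => (Ad_mul g h).symm
  have hAdone : Ad E (1 : G) = 1 := Ad_one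
  have hinv1 : ∀ h : G, Ad E h * Ad E h⁻¹ = 1 := fun h => by
    rw [hAdmul, mul_inv_cancel, hAdone]
  have hinv2 : ∀ h : G, Ad E h⁻¹ * Ad E h = 1 := fun h => by
    rw [hAdmul, inv_mul_cancel, hAdone]
  let F : G → ℂ := fun g => ξ (graphMap Q (Ad E (g₀⁻¹ * g)) y)
  let V : Set G := {g | IsUnit (graphDenominator Q (Ad E (g₀⁻¹ * g)))}
  have hinvF : ∀ g, ∀ h ∈ H, F (g * h) = F g := fun g h hh => by
    simp only [F]
    rw [← mul_assoc, ← hAdmul, graphMap_mul hQ (hAd h hh) (hAd h⁻¹ (H.inv_mem hh)) (hinv1 h)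
      (hinv2 h)]
  have hinvV : ∀ g, ∀ h ∈ H, g * h ∈ V → g ∈ V := fun g h hh hg => by
    have hg' : IsUnit (graphDenominator Q (Ad E (g₀⁻¹ * (g * h)))) := hg
    rw [← mul_assoc, ← hAdmul, isUnit_graphDenominator_mul hQ (hAd h hh)
      (hAd h⁻¹ (H.inv_mem hh)) (hinv1 h) (hinv2 h)] at hg'
    exact hg'
  have hMDAd : ∀ g : G, MDifferentiableAt 𝓘(ℂ, E) 𝓘(ℂ, E →L[ℂ] E)
      (fun g : G => Ad E (g₀⁻¹ * g)) g := fun g => by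
    obtain ⟨T, hT, -⟩ := exists_hasMFDerivAt_Ad (E := E) (g₀⁻¹ * g)
    exact hT.mdifferentiableAt.comp g
      ((contMDiff_mul_left (I := 𝓘(ℂ, E)) (n := ω) (a := g₀⁻¹)).mdifferentiableAt (by simp))
  have hVopen : IsOpen V := by
    have hc : Continuous fun g : G => graphDenominator Q (Ad E (g₀⁻¹ * g)) := by
      refine continuous_iff_continuousAt.2 fun g => ?_
      exact (hasFDerivAt_graphDenominator Q _).continuousAt.comp (hMDAd g).continuousAt
    exact Units.isOpen.preimage hc
  let ev : (E →L[ℂ] E) →L[ℂ] ℂ := ξ.comp (ContinuousLinearMap.apply ℂ E (y : E))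
  let Λ : (E →L[ℂ] E) →L[ℂ] ℂ := ev.comp (fderiv ℂ (graphMap Q) 1)
  refine ⟨QuotientGroup.mk '' V, Quotient.lift F fun a b hab => ?_,
    (Λ.comp D).comp (maurerCartan (E := E) g₀),
    QuotientGroup.isOpenMap_coe V hVopen, ⟨g₀, ?_, rfl⟩, ?_, ?_, ?_⟩
  · have h1 : a⁻¹ * b ∈ H := QuotientGroup.leftRel_apply.1 hab
    have h2 := hinvF a _ h1
    rw [mul_inv_cancel_left] at h2
    exact h2.symm
  · change IsUnit (graphDenominator Q (Ad E (g₀⁻¹ * g₀)))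
    rw [inv_mul_cancel, hAdone, graphDenominator_one hQ]
    exact isUnit_one
  · intro g hg
    obtain ⟨k, hk, hkg⟩ := hg
    have hgV : g ∈ V := by
      refine hinvV g (g⁻¹ * k) (QuotientGroup.eq.1 hkg.symm) ?_
      rwa [mul_inv_cancel_left]
    have h1 : DifferentiableAt ℂ (graphMap Q) (Ad E (g₀⁻¹ * g)) := differentiableAt_graphMap hgV
    have h2 := (ev.differentiableAt.comp _ h1).mdifferentiableAt.comp g (hMDAd g)
    exact h2.mdifferentiableWithinAt
  · have h1 : HasFDerivAt (graphMap Q) (fderiv ℂ (graphMap Q) 1) (1 : E →L[ℂ] E) := by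
      refine (differentiableAt_graphMap ?_).hasFDerivAt
      rw [graphDenominator_one hQ]
      exact isUnit_one
    have h2 : HasMFDerivAt 𝓘(ℂ, E) 𝓘(ℂ, E →L[ℂ] E) (fun g : G => Ad E (g₀⁻¹ * g)) g₀
        (D.comp (maurerCartan (E := E) g₀ : E →L[ℂ] E)) :=
      HasMFDerivAt.comp g₀ (hasMFDerivAt_of_eq hD (inv_mul_cancel g₀).symm)
        (hasMFDerivAt_maurerCartan (E := E) g₀)
    have h3 : HasFDerivAt (fun c => ξ (graphMap Q c y)) Λ
        (Ad E (g₀⁻¹ * g₀)) := by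
      rw [inv_mul_cancel, hAdone]
      exact ev.hasFDerivAt.comp 1 h1
    have h4 : HasMFDerivAt 𝓘(ℂ, E →L[ℂ] E) 𝓘(ℂ) (fun c : E →L[ℂ] E => ξ (graphMap Q c y))
      (Ad E (g₀⁻¹ * g₀)) Λ := h3.hasMFDerivAt
    have h5 := HasMFDerivAt.comp (f := fun g : G => Ad E (g₀⁻¹ * g)) g₀ h4 h2
    exact h5
  · have h1 := maurerCartan_leftTranslation (E := E) g₀ X
    have h2 : Λ (D X) = ξ (D X y - Q (D X y)) := by
      change ev (fderiv ℂ (graphMap Q) 1 (D X)) = _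
      rw [fderiv_graphMap_one hQ]
      change ξ (D X (Q y) - Q (D X (Q y))) = _
      rw [hQW y hy]
    intro h0
    refine hξ (h2.symm.trans (Eq.trans ?_ h0))
    exact congrArg (fun z : E => Λ (D z)) h1.symm

end LocalFunctions

/-! ### Holomorphic maps and the type components of the connection form -/

section Main

variable {E : Type*} [NormedAddCommGroup E] [NormedSpace ℂ E]
  {G : Type*} [TopologicalSpace G] [ChartedSpace E G] [Group G]
  {M : Type*} [TopologicalSpace M] [ChartedSpace ℂ M]

/-- The Cauchy-Riemann equation. -/
theorem mdifferentiableAt_iff_exists_map_I_mul {u : M → ℂ} {p : M} :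
    MDifferentiableAt 𝓘(ℂ) 𝓘(ℂ) u p ↔ ∃ Λ : ℂ →L[ℝ] ℂ,
      HasMFDerivAt 𝓘(ℝ, ℂ) 𝓘(ℝ, ℂ) u p Λ ∧ ∀ v, Λ (Complex.I * v) = Complex.I * Λ v := by
  constructor
  · intro h
    exact ⟨_, hasMFDerivAt_restrictScalars h.hasMFDerivAt,
      ContinuousLinearMap.map_smul (mfderiv 𝓘(ℂ) 𝓘(ℂ) u p : ℂ →L[ℂ] ℂ) Complex.I⟩
  · rintro ⟨Λ, hu, h⟩
    let Λ' : ℂ →L[ℂ] ℂ := (1 : ℂ →L[ℂ] ℂ).smulRight (Λ 1)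
    have h1 : Λ = Λ'.restrictScalars ℝ := ContinuousLinearMap.ext fun z => by
      change Λ z = z * Λ 1
      have hz : z = z.re • (1 : ℂ) + z.im • (Complex.I * 1) := by
        simp [mul_comm Complex.I]
      calc Λ z = Λ (z.re • (1 : ℂ) + z.im • (Complex.I * 1)) := by rw [← hz]
        _ = z.re • Λ 1 + z.im • (Complex.I * Λ 1) := by rw [map_add, map_smul, map_smul, h]
        _ = (z.re + z.im * Complex.I) * Λ 1 := by
          simp only [Complex.real_smul]; ring
        _ = z * Λ 1 := by rw [Complex.re_add_im]
    rw [h1] at hu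
    exact (HasMFDerivAt.of_restrictScalars hu).mdifferentiableAt

theorem hasMFDerivAt_conj_comp {u : M → ℂ} {p : M} {Λ : ℂ →L[ℝ] ℂ}
    (hu : HasMFDerivAt 𝓘(ℝ, ℂ) 𝓘(ℝ, ℂ) u p Λ) :
    HasMFDerivAt 𝓘(ℝ, ℂ) 𝓘(ℝ, ℂ) (fun q => starRingEnd ℂ (u q)) p
      ((Complex.conjCLE : ℂ →L[ℝ] ℂ).comp Λ) :=
  HasMFDerivAt.comp p (Complex.conjCLE : ℂ →L[ℝ] ℂ).hasFDerivAt.hasMFDerivAt hu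

/-- The Cauchy-Riemann equation of an antiholomorphic function. -/
theorem mdifferentiableAt_conj_iff_exists_map_I_mul {u : M → ℂ} {p : M} :
    MDifferentiableAt 𝓘(ℂ) 𝓘(ℂ) (fun q => starRingEnd ℂ (u q)) p ↔ ∃ Λ : ℂ →L[ℝ] ℂ,
      HasMFDerivAt 𝓘(ℝ, ℂ) 𝓘(ℝ, ℂ) u p Λ ∧ ∀ v, Λ (Complex.I * v) = -Complex.I * Λ v := by
  rw [mdifferentiableAt_iff_exists_map_I_mul]
  constructor
  · rintro ⟨Λ, hΛ, h⟩
    refine ⟨(Complex.conjCLE : ℂ →L[ℝ] ℂ).comp Λ, ?_, fun v => ?_⟩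
    · exact (hasMFDerivAt_conj_comp hΛ).congr_of_eventuallyEq
        (Eventually.of_forall fun q => (Complex.conj_conj (u q)).symm)
    · change starRingEnd ℂ (Λ (Complex.I * v)) = -Complex.I * starRingEnd ℂ (Λ v)
      rw [h, map_mul, Complex.conj_I]
  · rintro ⟨Λ, hΛ, h⟩
    refine ⟨_, hasMFDerivAt_conj_comp hΛ, fun v => ?_⟩
    change starRingEnd ℂ (Λ (Complex.I * v)) = Complex.I * starRingEnd ℂ (Λ v)
    rw [h, map_mul, map_neg, Complex.conj_I, neg_neg]

theorem takesValuesIn_part01_iff {V : Type*} [AddCommGroup V] [Module ℂ V] {α : OneForm M V}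
    {W : Submodule ℂ V} : TakesValuesIn (part01 α) W ↔
      ∀ (p : M) (v : ℂ), α p v + Complex.I • α p (Complex.I * v : ℂ) ∈ W :=
  forall₂_congr fun _ _ => W.smul_mem_iff (by norm_num : (1 / 2 : ℂ) ≠ 0)

theorem takesValuesIn_part10_iff {V : Type*} [AddCommGroup V] [Module ℂ V] {α : OneForm M V}
    {W : Submodule ℂ V} : TakesValuesIn (part10 α) W ↔
      ∀ (p : M) (v : ℂ), α p v + -Complex.I • α p (Complex.I * v : ℂ) ∈ W := by
  simp only [neg_smul, ← sub_eq_add_neg]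
  exact forall₂_congr fun _ _ => W.smul_mem_iff (by norm_num : (1 / 2 : ℂ) ≠ 0)

variable [LieGroup 𝓘(ℂ, E) ω G]

/-- The chain rule in terms of the connection form, by `dφ = dL_φ ∘ ω`. -/
theorem hasMFDerivAt_comp_of_connectionForm {φ : M → G} {p : M} {F : G → ℂ} {A : E →L[ℂ] ℂ}
    (hφ : MDifferentiableAt 𝓘(ℝ, ℂ) 𝓘(ℝ, E) φ p)
    (hF : HasMFDerivAt 𝓘(ℂ, E) 𝓘(ℂ) F (φ p) A) :
    ∃ Λ : ℂ →L[ℝ] ℂ, HasMFDerivAt 𝓘(ℝ, ℂ) 𝓘(ℝ, ℂ) (fun q => F (φ q)) p Λ ∧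
      ∀ v : ℂ, Λ v = A (leftTranslation E (φ p) (connectionForm (E := E) φ p v)) := by
  let dφ : ℂ →L[ℝ] E := mfderiv 𝓘(ℝ, ℂ) 𝓘(ℝ, E) φ p
  refine ⟨(A.restrictScalars ℝ).comp dφ,
    HasMFDerivAt.comp p (hasMFDerivAt_restrictScalars hF) hφ.hasMFDerivAt, fun v => ?_⟩
  exact congrArg A (leftTranslation_maurerCartan (φ p) (dφ v)).symm

variable [FiniteDimensional ℂ E]

/-- The one-parameter curve of `X ∈ 𝔥` stays in the subgroup: its value at `t` is `exp (t X)`. -/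
theorem exp_mem_connectedSubgroup {𝔥 : LieSubalgebra ℂ (GroupLieAlgebra 𝓘(ℂ, E) G)}
    {X : GroupLieAlgebra 𝓘(ℂ, E) G} (hX : X ∈ 𝔥) {γ : ℝ → G} (hγ₀ : γ 0 = 1)
    (hγ : IsMIntegralCurve (I := 𝓘(ℝ, E)) γ (leftInvariantField (E := E) X)) (t : ℝ) :
    γ t ∈ connectedSubgroup 𝔥 := by
  refine Subgroup.subset_closure ⟨(t : ℂ) • X, 𝔥.smul_mem _ hX, γ ∘ (· * t), by simp [hγ₀],
    by simp, ?_⟩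
  have h := hγ.comp_mul t
  have h2 : t • leftInvariantField (G := G) (E := E) X =
      leftInvariantField (E := E) ((t : ℂ) • X) := by
    funext g
    exact (ContinuousLinearMap.map_smul (leftTranslation E g) (t : ℂ) X).symm
  rw [h2] at h
  exact h

variable [T2Space G]

/-- The pullback of a function on `G ⧸ H` has vanishing derivative along `𝔥`, being constant on the
curves `g exp(tX)` with `X ∈ 𝔥`. -/
theorem map_leftTranslation_eq_zero {𝔥 : LieSubalgebra ℂ (GroupLieAlgebra 𝓘(ℂ, E) G)}
    {f : G ⧸ connectedSubgroup 𝔥 → ℂ} {g : G} {A : E →L[ℂ] ℂ}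
    (hA : HasMFDerivAt 𝓘(ℂ, E) 𝓘(ℂ) (fun g : G => f (QuotientGroup.mk g)) g A)
    {X : GroupLieAlgebra 𝓘(ℂ, E) G} (hX : X ∈ 𝔥) : A (leftTranslation E g X) = 0 := by
  have : CompleteSpace E := FiniteDimensional.complete ℂ E
  obtain ⟨γ, hγ₀, hγ⟩ := exists_integralCurve (E := E) (G := G) X
  have h1 := hasMFDerivAt_mul_left_curve g (hγ 0)
  have hg : g * γ 0 = g := by rw [hγ₀, mul_one]
  have h2 := hasDerivAt_comp_curve h1 (hasMFDerivAt_of_eq hA hg.symm)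
  have h3 : (fun s => f (QuotientGroup.mk (g * γ s))) = fun _ => f (QuotientGroup.mk g) := by
    funext s
    rw [QuotientGroup.mk_mul_of_mem g (exp_mem_connectedSubgroup hX hγ₀ hγ s)]
  rw [h3, hg] at h2
  exact h2.unique (hasDerivAt_const 0 _)

/-- The common core of the holomorphic case `c = i` and the antiholomorphic case `c = -i`. -/
theorem forall_holomorphicFun_iff {𝔥 : LieSubalgebra ℂ (GroupLieAlgebra 𝓘(ℂ, E) G)}
    (h𝔥 : ∀ x, (∀ y ∈ 𝔥, ⁅x, y⁆ ∈ 𝔥) → x ∈ 𝔥) {φ : M → G}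
    (hφ : MDifferentiable 𝓘(ℝ, ℂ) 𝓘(ℝ, E) φ) {c : ℂ} (hc : c * c = -1) :
    (∀ (U : Set (G ⧸ connectedSubgroup 𝔥)) (f : G ⧸ connectedSubgroup 𝔥 → ℂ), IsOpen U →
      IsHolomorphicFunOn E f U → ∀ p, QuotientGroup.mk (φ p) ∈ U → ∃ Λ : ℂ →L[ℝ] ℂ,
        HasMFDerivAt 𝓘(ℝ, ℂ) 𝓘(ℝ, ℂ) (fun q => f (QuotientGroup.mk (φ q))) p Λ ∧
          ∀ v, Λ (Complex.I * v) = c * Λ v) ↔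
      ∀ (p : M) (v : ℂ), connectionForm (E := E) φ p v +
        c • connectionForm (E := E) φ p (Complex.I * v : ℂ) ∈ 𝔥 := by
  have key : ∀ (A : E →L[ℂ] ℂ) (g : G) (a b : E), A (leftTranslation E g (a + c • b)) = 0 ↔
      A (leftTranslation E g b) = c * A (leftTranslation E g a) := by
    intro A g a b
    rw [map_add, map_smul, map_add, map_smul, smul_eq_mul]
    constructor
    · intro h
      linear_combination (-c) * h + A (leftTranslation E g b) * hc
    · intro h
      linear_combination c * h + A (leftTranslation E g a) * hc
  constructor
  · intro h p v
    refine h𝔥 _ ?_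
    by_contra hX
    obtain ⟨U, f, A, hU, hpU, hf, hA, hAX⟩ := exists_holomorphicFun hX (φ p)
    obtain ⟨Λ, hΛ, hΛv⟩ := hasMFDerivAt_comp_of_connectionForm (hφ p) hA
    obtain ⟨Λ', hΛ', hc'⟩ := h U f hU hf p hpU
    obtain rfl : Λ = Λ' := hasMFDerivAt_unique hΛ hΛ'
    refine hAX ((key A (φ p) _ _).2 ?_)
    have h1 := hc' v
    rw [hΛv, hΛv] at h1
    exact h1
  · intro h U f hU hf p hp
    have hopen : (QuotientGroup.mk ⁻¹' U : Set G) ∈ 𝓝 (φ p) :=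
      (hU.preimage QuotientGroup.continuous_mk).mem_nhds hp
    have hA := (hf.mdifferentiableAt hopen).hasMFDerivAt
    obtain ⟨Λ, hΛ, hΛv⟩ := hasMFDerivAt_comp_of_connectionForm (hφ p) hA
    refine ⟨Λ, hΛ, fun v => ?_⟩
    rw [hΛv, hΛv]
    exact (key _ (φ p) _ _).1 (map_leftTranslation_eq_zero hA (h p v))

theorem isHolomorphicMap_iff {𝔥 : LieSubalgebra ℂ (GroupLieAlgebra 𝓘(ℂ, E) G)}
    (h𝔥 : ∀ x, (∀ y ∈ 𝔥, ⁅x, y⁆ ∈ 𝔥) → x ∈ 𝔥) {φ : M → G}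
    (hφ : MDifferentiable 𝓘(ℝ, ℂ) 𝓘(ℝ, E) φ) :
    IsHolomorphicMap E (fun p => (QuotientGroup.mk (φ p) : G ⧸ connectedSubgroup 𝔥)) ↔
      TakesValuesIn (part01 (connectionForm (E := E) φ)) 𝔥.toSubmodule := by
  have hcont : Continuous fun p => (QuotientGroup.mk (φ p) : G ⧸ connectedSubgroup 𝔥) :=
    QuotientGroup.continuous_mk.comp hφ.continuous
  refine Iff.trans ?_ ((forall_holomorphicFun_iff h𝔥 hφ Complex.I_mul_I).trans
    takesValuesIn_part01_iff.symm)
  simp only [IsHolomorphicMap, hcont, true_and]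
  refine forall₄_congr fun U f hU _ => forall_congr' fun p => forall_congr' fun hp => ?_
  rw [← mdifferentiableAt_iff_exists_map_I_mul]
  exact ⟨fun h => h.mdifferentiableAt ((hU.preimage hcont).mem_nhds hp),
    fun h => h.mdifferentiableWithinAt⟩

theorem isAntiholomorphicMap_iff {𝔥 : LieSubalgebra ℂ (GroupLieAlgebra 𝓘(ℂ, E) G)}
    (h𝔥 : ∀ x, (∀ y ∈ 𝔥, ⁅x, y⁆ ∈ 𝔥) → x ∈ 𝔥) {φ : M → G}
    (hφ : MDifferentiable 𝓘(ℝ, ℂ) 𝓘(ℝ, E) φ) :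
    IsAntiholomorphicMap E (fun p => (QuotientGroup.mk (φ p) : G ⧸ connectedSubgroup 𝔥)) ↔
      TakesValuesIn (part10 (connectionForm (E := E) φ)) 𝔥.toSubmodule := by
  have hcont : Continuous fun p => (QuotientGroup.mk (φ p) : G ⧸ connectedSubgroup 𝔥) :=
    QuotientGroup.continuous_mk.comp hφ.continuous
  refine Iff.trans ?_ ((forall_holomorphicFun_iff (c := -Complex.I) h𝔥 hφ (by simp)).trans
    takesValuesIn_part10_iff.symm)
  simp only [IsAntiholomorphicMap, hcont, true_and]
  refine forall₄_congr fun U f hU _ => forall_congr' fun p => forall_congr' fun hp => ?_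
  rw [← mdifferentiableAt_conj_iff_exists_map_I_mul]
  exact ⟨fun h => h.mdifferentiableAt ((hU.preimage hcont).mem_nhds hp),
    fun h => h.mdifferentiableWithinAt⟩

end Main

end TodaGeometry

end

theorem theorem2p1
    {E : Type*} [NormedAddCommGroup E] [NormedSpace ℂ E] [FiniteDimensional ℂ E]
    {G : Type*} [TopologicalSpace G] [T2Space G] [ChartedSpace E G] [Group G]
    [LieGroup 𝓘(ℂ, E) ω G]
    [LieAlgebra.IsSemisimple ℂ (GroupLieAlgebra 𝓘(ℂ, E) G)]
    {M : Type*} [TopologicalSpace M] [ChartedSpace ℂ M] [IsManifold 𝓘(ℂ) ω M]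
    (𝒜 : TodaGeometry.ZGradation (GroupLieAlgebra 𝓘(ℂ, E) G))
    (φ : M → G) (hφ : ContMDiff 𝓘(ℝ, ℂ) 𝓘(ℝ, E) ∞ φ) :
    TodaGeometry.GradingCondition 𝒜 (TodaGeometry.connectionForm (E := E) φ) ↔
      TodaGeometry.IsHolomorphicMap E (TodaGeometry.phiMinus 𝒜 φ) ∧
        TodaGeometry.IsAntiholomorphicMap E (TodaGeometry.phiPlus 𝒜 φ) := by
  have : FiniteDimensional ℂ (GroupLieAlgebra 𝓘(ℂ, E) G) := inferInstanceAs (FiniteDimensional ℂ E)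
  have hφ' : MDifferentiable 𝓘(ℝ, ℂ) 𝓘(ℝ, E) φ := hφ.mdifferentiable (by simp)
  have hMinus := TodaGeometry.isHolomorphicMap_iff 𝒜.bPlus_self_normalizing hφ'
  have hPlus := TodaGeometry.isAntiholomorphicMap_iff 𝒜.bMinus_self_normalizing hφ'
  exact and_comm.trans (and_congr hMinus.symm hPlus.symm)
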